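/- Let $n\ge 2$ and let $\Gamma$ be a nontrivial group of isometries of the round unit sphere $\mathbb S^{n+1}$ acting properly discontinuously, i.e. every point has a neighbourhood $U$ with $U\cap g(U)=\emptyset$ for all $g\in\Gamma\setminus\{e\}$. Let $\pi:\mathbb S^{n+1}\to\mathbb S^{n+1}/\Gamma$ be the canonical projection, where the quotient carries the Riemannian metric making $\pi$ a Riemannian covering. Let $x_0\in\mathbb S^{n+1}/\Gamma$, $p_0\in\pi^{-1}(x_0)$, let $C(x_0)$ be the cut locus of $x_0$, and put $$r=\min_{g\in\Gamma\setminus\{e\}}d(p_0,g(p_0)).$$ Let $M^n$ be a closed (compact without boundary), connected smooth immersed hypersurface of $\mathbb S^{n+1}/\Gamma$, with immersion $\iota:M\to\mathbb S^{n+1}/\Gamma$ (for instance an embedded hypersurface, with $\iota$ the inclusion), such that $d(\iota(x),C(x_0))\le R$ for all $x\in M$, where $R\in(0,r/2)$. Suppose that the principal curvatures $\lambda_1,\dots,\lambda_n$ of $M$ (whose absolute values do not depend on the choice of a local unit normal) satisfy $$\inf_{x\in M}|\lambda_i(x)|>\cot\Big(\frac{r-2R}{4}\Big)=\tan\Big(\frac{\pi-r/2+R}{2}\Big),\qquad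 i=1,\dots,n .$$ Let $\tilde M=\{(x,p)\in M\times\mathbb S^{n+1}:\iota(x)=\pi(p)\}$ (which is $\pi^{-1}(M)$ if $M$ is embedded), and let $k$ be the number of its connected components. Then $\Gamma$ is finite and there is a $(|\Gamma|/k)$-to-one covering map from $\mathbb S^n$ to $M$ via the action of $\Gamma$. Precisely, there are a covering map $f:\mathbb S^n\to M$ that is a smooth local diffeomorphism and all of whose fibres have exactly $|\Gamma|/k$ elements, and a smooth map $\varphi:\mathbb S^n\to\mathbb S^{n+1}$ with $\iota\circ f=\pi\circ\varphi$, such that $u\mapsto(f(u),\varphi(u))$ is a homeomorphism of $\mathbb S^n$ onto a connected component of $\tilde M$; moreover there are a subgroup $H\le\Gamma$ of order $|\Gamma|/k$ and a smooth free action of $H$ on $\mathbb S^n$, for which $\varphi$ is equivariant, such that $f$ is the quotient map of $\mathbb S^n$ by this action. -/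

import Mathlib

open scoped Manifold ContDiff Topology

noncomputable section

/-- The unit sphere `S^m` of the Euclidean space `ℝ^(m+1)`. -/
abbrev USphere (m : ℕ) : Type := Metric.sphere (0 : EuclideanSpace ℝ (Fin (m + 1))) 1

/-! ### Groups acting properly discontinuously -/

/-- The action of `Γ` on `X` is properly discontinuous: every point has a neighbourhood `U`
such that `U ∩ g(U) = ∅` for all `g ≠ 1`. (In particular the action is free, hence faithful.) -/
class ActsProperlyDiscontinuously (Γ X : Type*) [Group Γ] [TopologicalSpace X]
    [MulAction Γ X] : Prop where
  exists_nhds : ∀ p : X, ∃ U ∈ 𝓝 p, ∀ g : Γ, g ≠ 1 → Disjoint U ((fun x => g • x) '' U)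

/-- Such an action is free. -/
instance ActsProperlyDiscontinuously.isCancelSMul {Γ X : Type*} [Group Γ] [TopologicalSpace X]
    [MulAction Γ X] [ActsProperlyDiscontinuously Γ X] : IsCancelSMul Γ X := by
  refine isCancelSMul_iff_eq_one_of_smul_eq.mpr fun g x hx => ?_
  by_contra hg
  obtain ⟨U, hU, h⟩ := ActsProperlyDiscontinuously.exists_nhds (Γ := Γ) x
  have hxU := mem_of_mem_nhds hU
  exact Set.disjoint_left.mp (h g hg) hxU ⟨x, hxU, hx⟩

/-- On a compact space such an action is properly discontinuous in Mathlib's sense; this makes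
Mathlib's charted space structure on the quotient available. -/
instance ActsProperlyDiscontinuously.properlyDiscontinuousSMul {Γ X : Type*} [Group Γ]
    [TopologicalSpace X] [CompactSpace X] [MulAction Γ X] [ActsProperlyDiscontinuously Γ X] :
    ProperlyDiscontinuousSMul Γ X where
  finite_disjoint_inter_image := by
    intro K L _ _
    rcases isEmpty_or_nonempty X with hX | ⟨⟨x⟩⟩
    · convert Set.finite_empty
      ext g
      simp [Set.eq_empty_of_isEmpty]
    · choose U hU h using ActsProperlyDiscontinuously.exists_nhds (Γ := Γ) (X := X)
      obtain ⟨t, ht⟩ := CompactSpace.elim_nhds_subcover U hU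
      have key : ∀ g : Γ, ∃ i : t, g • x ∈ U i := by
        intro g
        have : g • x ∈ ⋃ i ∈ t, U i := by rw [ht]; trivial
        simpa using this
      choose i hi using key
      have inj : Function.Injective i := by
        intro g g' hgg
        by_contra hne
        have h1 : g' * g⁻¹ ≠ 1 := fun h1 => hne (mul_inv_eq_one.mp h1).symm
        have h2 := hi g'
        rw [← hgg] at h2
        exact Set.disjoint_left.mp (h (i g) _ h1) h2 ⟨g • x, hi g, by simp [mul_smul]⟩
      have : Finite Γ := Finite.of_injective i inj
      exact Set.toFinite _

/-! ### The space form `S^m / Γ`, its distance and its cut loci -/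

/-- The quotient `S^m / Γ`. Under the assumptions of the theorem Mathlib equips it with the
quotient topology and with the charts obtained by composing local inverses of the projection
with the charts of the sphere. -/
abbrev SpaceForm (Γ : Type*) (m : ℕ) [Group Γ] [MulAction Γ (USphere m)] : Type :=
  MulAction.orbitRel.Quotient Γ (USphere m)

/-- The canonical projection `π : S^m → S^m / Γ`. -/
def spaceFormProj (Γ : Type*) {m : ℕ} [Group Γ] [MulAction Γ (USphere m)] (p : USphere m) :
    SpaceForm Γ m :=
  Quotient.mk (MulAction.orbitRel Γ (USphere m)) p

/-- The geodesic distance of the round unit sphere. (A bijection of the sphere preserves it if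
and only if it preserves the chordal distance, which is Mathlib's metric on the sphere.) -/
def sphereDist {m : ℕ} (p q : USphere m) : ℝ :=
  InnerProductGeometry.angle (p : EuclideanSpace ℝ (Fin (m + 1))) q

/-- The Riemannian distance of `S^m / Γ`, for the metric that makes `π` a Riemannian covering:
the distance between the corresponding orbits. -/
def spaceFormDist {Γ : Type*} {m : ℕ} [Group Γ] [MulAction Γ (USphere m)]
    (x y : SpaceForm Γ m) : ℝ :=
  sInf {d : ℝ | ∃ p q : USphere m,
    spaceFormProj Γ p = x ∧ spaceFormProj Γ q = y ∧ sphereDist p q = d}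

/-- The distance from a point of `S^m / Γ` to a subset. -/
def spaceFormInfDist {Γ : Type*} {m : ℕ} [Group Γ] [MulAction Γ (USphere m)]
    (x : SpaceForm Γ m) (C : Set (SpaceForm Γ m)) : ℝ :=
  sInf ((fun y => spaceFormDist x y) '' C)

/-- The unit tangent vectors of the sphere at `p`. -/
abbrev UnitTangent {m : ℕ} (p : USphere m) : Type :=
  {v : EuclideanSpace ℝ (Fin (m + 1)) //
    ‖v‖ = 1 ∧ inner ℝ (p : EuclideanSpace ℝ (Fin (m + 1))) v = 0}

/-- The unit speed geodesic `t ↦ exp_p (t v) = cos t • p + sin t • v` of the sphere. -/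
def sphereGeodesic {m : ℕ} (p : USphere m) (v : UnitTangent p) (t : ℝ) : USphere m :=
  ⟨Real.cos t • (p : EuclideanSpace ℝ (Fin (m + 1))) + Real.sin t • v.1, by
    have hp : ‖(p : EuclideanSpace ℝ (Fin (m + 1)))‖ = 1 := norm_eq_of_mem_sphere p
    have h : ‖Real.cos t • (p : EuclideanSpace ℝ (Fin (m + 1))) + Real.sin t • v.1‖ ^ 2 = 1 := by
      rw [norm_add_sq_real, norm_smul, norm_smul, inner_smul_left, inner_smul_right, v.2.2, hp,
        v.2.1]
      simp
    rw [mem_sphere_zero_iff_norm]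
    nlinarith [norm_nonneg (Real.cos t • (p : EuclideanSpace ℝ (Fin (m + 1))) +
      Real.sin t • v.1)]⟩

/-- The cut locus of `x` in `S^m / Γ`. The unit speed geodesics issuing from `x` are the images
`γ` under `π` of the unit speed geodesics of the sphere issuing from points over `x`; the cut
point of `x` along `γ` is `γ t`, where `t` is the last time with `d (x, γ t) = t`. -/
def cutLocus {Γ : Type*} {m : ℕ} [Group Γ] [MulAction Γ (USphere m)] (x : SpaceForm Γ m) :
    Set (SpaceForm Γ m) :=
  {y | ∃ (p : USphere m) (v : UnitTangent p) (t : ℝ), spaceFormProj Γ p = x ∧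
    IsGreatest {s : ℝ | 0 ≤ s ∧
      spaceFormDist x (spaceFormProj Γ (sphereGeodesic p v s)) = s} t ∧
    y = spaceFormProj Γ (sphereGeodesic p v t)}

/-! ### Principal curvatures -/

section PrincipalCurvature

variable {n : ℕ} {M : Type*} [TopologicalSpace M] [ChartedSpace (EuclideanSpace ℝ (Fin n)) M]

/-- `η` is, at `y`, a unit normal of the hypersurface `f : M → S^(n+1)`: a unit vector tangent
to the sphere and orthogonal to the image of the differential of `f`. -/
def IsUnitNormalAt (f : M → USphere (n + 1)) (η : M → EuclideanSpace ℝ (Fin (n + 2)))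
    (y : M) : Prop :=
  ‖η y‖ = 1 ∧ inner ℝ (η y) (f y : EuclideanSpace ℝ (Fin (n + 2))) = 0 ∧
    ∀ v : TangentSpace (𝓡 n) y, inner ℝ (η y)
      (mfderiv (𝓡 n) 𝓘(ℝ, EuclideanSpace ℝ (Fin (n + 2)))
        (fun z => (f z : EuclideanSpace ℝ (Fin (n + 2)))) y v :
          EuclideanSpace ℝ (Fin (n + 2))) = 0

/-- The derivative at `x` in the direction `v`, for the Riemannian connection of the sphere, of a
vector field `η` along `f : M → S^(n+1)`: the component of the Euclidean derivative that is
tangent to the sphere. -/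
def sphereCovDeriv (f : M → USphere (n + 1)) (η : M → EuclideanSpace ℝ (Fin (n + 2))) (x : M)
    (v : TangentSpace (𝓡 n) x) : EuclideanSpace ℝ (Fin (n + 2)) :=
  let w : EuclideanSpace ℝ (Fin (n + 2)) :=
    mfderiv (𝓡 n) 𝓘(ℝ, EuclideanSpace ℝ (Fin (n + 2))) η x v
  w - inner ℝ w (f x : EuclideanSpace ℝ (Fin (n + 2))) •
    (f x : EuclideanSpace ℝ (Fin (n + 2)))

/-- `μ` is a principal curvature at `x` of the hypersurface `ι : M → S^(n+1) / Γ`, i.e. an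
eigenvalue of the shape operator `A v = -∇_v η`. As `π` is a local isometry, it is computed with
a smooth local lift `f` of `ι` to the sphere and a smooth unit normal field `η` along `f`. The
choice of `η` among the two local unit normals affects only the sign of `μ`. -/
def IsPrincipalCurvature {Γ : Type*} [Group Γ] [MulAction Γ (USphere (n + 1))]
    (ι : M → SpaceForm Γ (n + 1)) (x : M) (μ : ℝ) : Prop :=
  ∃ (U : Set M) (f : M → USphere (n + 1)) (η : M → EuclideanSpace ℝ (Fin (n + 2))),
    IsOpen U ∧ x ∈ U ∧
    (∀ y ∈ U, spaceFormProj Γ (f y) = ι y) ∧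
    ContMDiffOn (𝓡 n) (𝓡 (n + 1)) ∞ f U ∧
    ContMDiffOn (𝓡 n) 𝓘(ℝ, EuclideanSpace ℝ (Fin (n + 2))) ∞ η U ∧
    (∀ y ∈ U, IsUnitNormalAt f η y) ∧
    ∃ v : TangentSpace (𝓡 n) x, v ≠ 0 ∧
      -sphereCovDeriv f η x v = μ •
        (mfderiv (𝓡 n) 𝓘(ℝ, EuclideanSpace ℝ (Fin (n + 2)))
          (fun z => (f z : EuclideanSpace ℝ (Fin (n + 2)))) x v :
            EuclideanSpace ℝ (Fin (n + 2)))

end PrincipalCurvature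

/-! ### The preimage of a hypersurface -/

/-- The preimage `π⁻¹(M)` of the (possibly non-injectively) immersed hypersurface
`ι : M → S^m / Γ`: the fibre product of `ι` and `π`. -/
abbrev HypersurfacePreimage {Γ : Type*} {m : ℕ} [Group Γ] [MulAction Γ (USphere m)] {M : Type*}
    (ι : M → SpaceForm Γ m) : Type _ :=
  Function.Pullback ι (spaceFormProj Γ (m := m))

/-- If `ι` is an embedding, this is the preimage, in the sphere, of the image of `ι`. -/
def HypersurfacePreimage.homeomorphPreimage {Γ : Type*} {m : ℕ} [Group Γ]
    [MulAction Γ (USphere m)] {M : Type*} [TopologicalSpace M] (ι : M → SpaceForm Γ m)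
    (hι : Topology.IsEmbedding ι) :
    HypersurfacePreimage ι ≃ₜ (spaceFormProj Γ (m := m)) ⁻¹' Set.range ι where
  toFun z := ⟨z.1.2, z.1.1, z.2⟩
  invFun q := ⟨(hι.toHomeomorph.symm ⟨spaceFormProj Γ q.1, q.2⟩, q.1),
    congrArg Subtype.val (hι.toHomeomorph.apply_symm_apply ⟨spaceFormProj Γ q.1, q.2⟩)⟩
  left_inv z := by
    obtain ⟨⟨x, p⟩, h⟩ := z
    apply Subtype.ext
    refine Prod.ext ?_ rfl
    apply hι.injective
    exact (congrArg Subtype.val (hι.toHomeomorph.apply_symm_apply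
      ⟨spaceFormProj Γ p, ⟨x, h⟩⟩)).trans h.symm
  right_inv q := rfl
  continuous_toFun := by fun_prop
  continuous_invFun := by
    have hπ : Continuous (spaceFormProj Γ (m := m)) := continuous_quotient_mk'
    refine Continuous.subtype_mk (Continuous.prodMk ?_ continuous_subtype_val) _
    exact hι.toHomeomorph.symm.continuous.comp
      (Continuous.subtype_mk (hπ.comp continuous_subtype_val) _)

end

/-!
Every point `p` of the sphere over the hypersurface has distance at least `2a = r / 2 - R` from
`p₀`: cut points of `x₀` have distance at least `r / 2` from `x₀` (`sub_le_sphereDist`). Away from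
`p₀`, a unit normal `ζ` at `p` can be translated along the great circle from `p` to `-p₀`, with
result `ζ + c (p - p₀)`, `c = ⟪ζ, p₀⟫ / (1 - ⟪p, p₀⟫)` (`gaussVector`); equivalently, this is the
Euclidean Gauss map of the stereographic image. The translate is a unit vector orthogonal to `p₀`,
so one gets a Gauss map with values in an `n`-sphere. A tangent vector in the kernel of its
differential is a principal direction with principal curvature `c`
(`IsOrientedLift.isPrincipalCurvature`). But `|c| ≤ cot a` (`abs_inner_div_le_cot`), while the
principal curvatures exceed `cot a` in absolute value. So the Gauss map is a local diffeomorphism.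

As the hypersurface is not assumed to be orientable, the Gauss map is defined on the
`orientedPreimage`, the compact space of triples of a point `x` of `M`, a point `p` of the sphere
over `ι x`, and a unit normal at `p`. Each component of it covers the `n`-sphere, which for `n ≥ 2`
has no nontrivial connected coverings (`IsLocalHomeomorph.bijective_of_sphere`), and hence is
homeomorphic to the sphere by the Gauss map (`IsGaussMap.exists_section`).

Forgetting the normal is injective on such a component (`IsGaussMap.eq_of_eq`). Otherwise the
component is invariant under the reversal of normals, for which the Gauss map is odd. The height in
the direction `e` of the stereographic image is critical only where the Gauss map is `±e`, that is,
at two points interchanged by the reversal, which lie over the same point of the sphere. So the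
maximum and the minimum of the height agree, the height is constant, and all points are critical,
which is absurd. Hence the component maps homeomorphically onto a component of the preimage
`π⁻¹(M)`, which is thereby parametrized by the sphere.

The group `Γ` acts freely on the preimage, with the fibres of the projection to `M` as orbits, and
permutes the components transitively, since each of them maps onto the connected space `M`. So the
restriction of the projection to a component is the quotient map by the stabilizer `H` of the
component, and `k * |H| = |Γ|` (`IsLocalHomeomorph.exists_isQuotientCoveringMap`). Smoothness of
the parametrization and of the action of `H` holds because the Gauss map, read locally in `M`, is a
local diffeomorphism.
-/

noncomputable section

/-! ### Distance to the base point -/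

section Distance

variable {m : ℕ}

theorem inner_eq_one_sub_dist (p q : USphere m) :
    inner ℝ (p : EuclideanSpace ℝ (Fin (m + 1))) q = 1 - dist p q ^ 2 / 2 := by
  have hp : ‖(p : EuclideanSpace ℝ (Fin (m + 1)))‖ = 1 := norm_eq_of_mem_sphere p
  have hq : ‖(q : EuclideanSpace ℝ (Fin (m + 1)))‖ = 1 := norm_eq_of_mem_sphere q
  rw [Subtype.dist_eq, dist_eq_norm, norm_sub_sq_real, hp, hq]
  ring

theorem sphereDist_eq_arccos (p q : USphere m) :
    sphereDist p q = Real.arccos (inner ℝ (p : EuclideanSpace ℝ (Fin (m + 1))) q) := by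
  rw [sphereDist, InnerProductGeometry.angle, norm_eq_of_mem_sphere, norm_eq_of_mem_sphere]
  simp

theorem sphereDist_nonneg (p q : USphere m) : 0 ≤ sphereDist p q :=
  InnerProductGeometry.angle_nonneg _ _

theorem sphereDist_le_pi (p q : USphere m) : sphereDist p q ≤ Real.pi :=
  InnerProductGeometry.angle_le_pi _ _

theorem sphereDist_comm (p q : USphere m) : sphereDist p q = sphereDist q p :=
  InnerProductGeometry.angle_comm _ _

theorem sphereDist_triangle (p q s : USphere m) :
    sphereDist p s ≤ sphereDist p q + sphereDist q s :=
  InnerProductGeometry.angle_le_angle_add_angle _ _ _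

theorem inner_sphereGeodesic (p : USphere m) (v : UnitTangent p) (s : ℝ) :
    inner ℝ (p : EuclideanSpace ℝ (Fin (m + 1))) (sphereGeodesic p v s) = Real.cos s := by
  simp [sphereGeodesic, inner_add_right, inner_smul_right, v.2.2]

theorem sphereDist_sphereGeodesic (p : USphere m) (v : UnitTangent p) {s : ℝ} (h0 : 0 ≤ s)
    (hs : s ≤ Real.pi) : sphereDist p (sphereGeodesic p v s) = s := by
  rw [sphereDist_eq_arccos, inner_sphereGeodesic, Real.arccos_cos h0 hs]

variable {Γ : Type*} [Group Γ] [MulAction Γ (USphere m)]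

theorem spaceFormProj_smul (g : Γ) (p : USphere m) :
    spaceFormProj Γ (g • p) = spaceFormProj Γ p :=
  Quotient.sound ⟨g, rfl⟩

theorem spaceFormProj_eq_iff {p q : USphere m} :
    spaceFormProj Γ p = spaceFormProj Γ q ↔ ∃ g : Γ, g • q = p := by
  rw [spaceFormProj, spaceFormProj, Quotient.eq]
  rfl

theorem spaceFormProj_surjective : Function.Surjective (spaceFormProj Γ (m := m)) :=
  Quotient.mk_surjective

theorem spaceFormDist_bddBelow (x y : SpaceForm Γ m) :
    BddBelow {d : ℝ | ∃ p q : USphere m,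
      spaceFormProj Γ p = x ∧ spaceFormProj Γ q = y ∧ sphereDist p q = d} :=
  ⟨0, by rintro _ ⟨p, q, _, _, rfl⟩; exact sphereDist_nonneg p q⟩

theorem spaceFormDist_le (p q : USphere m) :
    spaceFormDist (spaceFormProj Γ p) (spaceFormProj Γ q) ≤ sphereDist p q :=
  csInf_le (spaceFormDist_bddBelow _ _) ⟨p, q, rfl, rfl, rfl⟩

theorem spaceFormDist_nonneg (x y : SpaceForm Γ m) : 0 ≤ spaceFormDist x y :=
  Real.sInf_nonneg (by rintro _ ⟨p, q, _, _, rfl⟩; exact sphereDist_nonneg p q)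

theorem exists_sphereDist_lt {x y : SpaceForm Γ m} {d : ℝ} (h : spaceFormDist x y < d) :
    ∃ p q : USphere m, spaceFormProj Γ p = x ∧ spaceFormProj Γ q = y ∧ sphereDist p q < d := by
  obtain ⟨p, rfl⟩ := spaceFormProj_surjective x
  obtain ⟨q, rfl⟩ := spaceFormProj_surjective y
  obtain ⟨_, ⟨p', q', hp, hq, rfl⟩, hd⟩ :=
    exists_lt_of_csInf_lt (by exact ⟨_, p, q, rfl, rfl, rfl⟩) h
  exact ⟨p', q', hp, hq, hd⟩

theorem spaceFormDist_comm (x y : SpaceForm Γ m) : spaceFormDist x y = spaceFormDist y x := by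
  unfold spaceFormDist
  congr 1
  ext d
  exact ⟨fun ⟨p, q, h1, h2, h3⟩ => ⟨q, p, h2, h1, by rw [sphereDist_comm, h3]⟩,
    fun ⟨p, q, h1, h2, h3⟩ => ⟨q, p, h2, h1, by rw [sphereDist_comm, h3]⟩⟩

variable [IsIsometricSMul Γ (USphere m)]

theorem inner_smul_smul (g : Γ) (p q : USphere m) :
    inner ℝ ((g • p : USphere m) : EuclideanSpace ℝ (Fin (m + 1))) (g • q : USphere m) =
      inner ℝ (p : EuclideanSpace ℝ (Fin (m + 1))) q := by
  rw [inner_eq_one_sub_dist, inner_eq_one_sub_dist, dist_smul]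

theorem sphereDist_smul (g : Γ) (p q : USphere m) :
    sphereDist (g • p) (g • q) = sphereDist p q := by
  rw [sphereDist_eq_arccos, sphereDist_eq_arccos, inner_smul_smul]

theorem spaceFormDist_triangle (x y z : SpaceForm Γ m) :
    spaceFormDist x z ≤ spaceFormDist x y + spaceFormDist y z := by
  refine le_of_forall_pos_lt_add fun ε hε => ?_
  obtain ⟨p, q, rfl, rfl, h1⟩ := exists_sphereDist_lt (d := spaceFormDist x y + ε / 2)
    (by linarith : spaceFormDist x y < _)
  obtain ⟨q', s, hq, rfl, h2⟩ := exists_sphereDist_lt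
    (d := spaceFormDist (spaceFormProj Γ q) z + ε / 2)
    (by linarith : spaceFormDist (spaceFormProj Γ q) z < _)
  obtain ⟨g, rfl⟩ := spaceFormProj_eq_iff.1 hq
  have h3 := spaceFormDist_le (Γ := Γ) p (g⁻¹ • s)
  have h4 := sphereDist_triangle p q (g⁻¹ • s)
  have h5 := sphereDist_smul g q (g⁻¹ • s)
  rw [smul_inv_smul] at h5
  rw [spaceFormProj_smul] at h3
  linarith

theorem abs_spaceFormDist_sub_le (x y z : SpaceForm Γ m) :
    |spaceFormDist x y - spaceFormDist x z| ≤ spaceFormDist y z := by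
  have h1 := spaceFormDist_triangle x y z
  have h2 := spaceFormDist_triangle x z y
  rw [spaceFormDist_comm z y] at h2
  rw [abs_le]
  constructor <;> linarith

theorem continuous_sphereGeodesic (p : USphere m) (v : UnitTangent p) :
    Continuous (sphereGeodesic p v) :=
  Continuous.subtype_mk (by fun_prop) _

theorem continuous_spaceFormDist_proj (x : SpaceForm Γ m) :
    Continuous fun p : USphere m => spaceFormDist x (spaceFormProj Γ p) := by
  rw [continuous_iff_continuousAt]
  intro p
  have h : Filter.Tendsto (fun q => sphereDist q p) (𝓝 p) (𝓝 0) := by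
    have hc : Continuous fun q : USphere m => sphereDist q p := by
      simp only [sphereDist_eq_arccos]
      fun_prop
    have h0 : sphereDist p p = 0 := by
      rw [sphereDist, InnerProductGeometry.angle_self (ne_zero_of_mem_unit_sphere p)]
    simpa [h0] using hc.tendsto p
  rw [ContinuousAt, tendsto_iff_dist_tendsto_zero]
  refine squeeze_zero (fun _ => dist_nonneg) (fun q => ?_) h
  rw [Real.dist_eq]
  exact (abs_spaceFormDist_sub_le _ _ _).trans (spaceFormDist_le q p)

/-- Within half the displacement `r`, the projection preserves the distance from the base
point along radial geodesics. -/
theorem spaceFormDist_sphereGeodesic {x₀ : SpaceForm Γ m} {p₀ : USphere m}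
    (hp₀ : spaceFormProj Γ p₀ = x₀) {r : ℝ}
    (hr : ∀ g : Γ, g ≠ 1 → r ≤ sphereDist p₀ (g • p₀))
    {p : USphere m} (hp : spaceFormProj Γ p = x₀) (v : UnitTangent p) {s : ℝ} (h0 : 0 ≤ s)
    (hs : s ≤ Real.pi) (hsr : s ≤ r / 2) :
    spaceFormDist x₀ (spaceFormProj Γ (sphereGeodesic p v s)) = s := by
  have hd := sphereDist_sphereGeodesic p v h0 hs
  have hd' := spaceFormDist_le (Γ := Γ) p (sphereGeodesic p v s)
  rw [hd, hp] at hd'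
  refine le_antisymm hd' (le_of_forall_pos_lt_add fun ε hε => ?_)
  by_contra! hlt
  obtain ⟨a, b, ha, hb, hab⟩ := exists_sphereDist_lt
    (d := s) (by linarith : spaceFormDist x₀ (spaceFormProj Γ (sphereGeodesic p v s)) < s)
  obtain ⟨g, rfl⟩ := spaceFormProj_eq_iff.1 hb
  obtain ⟨h, rfl⟩ := spaceFormProj_eq_iff.1 (ha.trans hp₀.symm)
  obtain ⟨l, rfl⟩ := spaceFormProj_eq_iff.1 (hp.trans hp₀.symm)
  have e1 : sphereDist ((g⁻¹ * h) • p₀) (sphereGeodesic (l • p₀) v s) < s := by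
    rw [← sphereDist_smul g, smul_smul, mul_inv_cancel_left]
    exact hab
  by_cases hg : l⁻¹ * (g⁻¹ * h) = 1
  · have : g⁻¹ * h = l := (inv_mul_eq_one.1 hg).symm
    rw [this, hd] at e1
    exact lt_irrefl _ e1
  · have e2 := hr _ hg
    rw [← sphereDist_smul l, smul_smul, mul_inv_cancel_left] at e2
    have e3 := sphereDist_triangle (l • p₀) (sphereGeodesic (l • p₀) v s) ((g⁻¹ * h) • p₀)
    rw [hd, sphereDist_comm (sphereGeodesic _ _ _)] at e3
    linarith

/-- On a sphere of positive dimension, the cut locus of a point is nonempty. -/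
theorem cutLocus_nonempty {m : ℕ} {Γ : Type*} [Group Γ] [MulAction Γ (USphere (m + 1))]
    [IsIsometricSMul Γ (USphere (m + 1))] (p : USphere (m + 1)) :
    (cutLocus (spaceFormProj Γ p)).Nonempty := by
  obtain ⟨v, hv⟩ : ∃ v : EuclideanSpace ℝ (Fin (m + 2)),
      v ∈ (ℝ ∙ (p : EuclideanSpace ℝ (Fin (m + 2))))ᗮ ∧ ‖v‖ = 1 := by
    have : Nontrivial (ℝ ∙ (p : EuclideanSpace ℝ (Fin (m + 2))))ᗮ := by
      have : Fact (Module.finrank ℝ (EuclideanSpace ℝ (Fin (m + 2))) = m + 1 + 1) := ⟨by simp⟩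
      refine Module.nontrivial_of_finrank_pos (R := ℝ) ?_
      rw [Submodule.finrank_orthogonal_span_singleton (n := m + 1)
        (ne_zero_of_mem_unit_sphere p)]
      omega
    obtain ⟨w, hw⟩ := exists_norm_eq (ℝ ∙ (p : EuclideanSpace ℝ (Fin (m + 2))))ᗮ
      (zero_le_one (α := ℝ))
    exact ⟨w, w.2, hw⟩
  let w : UnitTangent p := ⟨v, hv.2, Submodule.mem_orthogonal_singleton_iff_inner_right.1 hv.1⟩
  let S : Set ℝ := {s : ℝ | 0 ≤ s ∧
      spaceFormDist (spaceFormProj Γ p) (spaceFormProj Γ (sphereGeodesic p w s)) = s}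
  have hS : IsClosed S := by
    refine (isClosed_le continuous_const continuous_id).inter (isClosed_eq ?_ continuous_id)
    exact (continuous_spaceFormDist_proj (Γ := Γ) (spaceFormProj Γ p)).comp
      (continuous_sphereGeodesic p w)
  have hb : BddAbove S := ⟨Real.pi, fun s hs => by
    rw [← hs.2]
    exact (spaceFormDist_le _ _).trans (sphereDist_le_pi _ _)⟩
  have hn : S.Nonempty := ⟨0, le_rfl, le_antisymm
    ((spaceFormDist_le _ _).trans_eq (sphereDist_sphereGeodesic p w le_rfl Real.pi_pos.le))
    (spaceFormDist_nonneg _ _)⟩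
  exact ⟨_, p, w, sSup S, rfl, ⟨hS.csSup_mem hn hb, fun s hs => le_csSup hb hs⟩, rfl⟩

/-- Points within `R` of the cut locus of `x₀` have distance at least `r / 2 - R` from every
point over `x₀`: cut points have distance at least `r / 2` from `x₀`. -/
theorem sub_le_sphereDist {m : ℕ} {Γ : Type*} [Group Γ] [MulAction Γ (USphere (m + 1))]
    [IsIsometricSMul Γ (USphere (m + 1))] {x₀ : SpaceForm Γ (m + 1)} {p₀ : USphere (m + 1)}
    (hp₀ : spaceFormProj Γ p₀ = x₀) {r R : ℝ} (hrpi : r ≤ Real.pi) (hr0 : 0 ≤ r)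
    (hr : ∀ g : Γ, g ≠ 1 → r ≤ sphereDist p₀ (g • p₀)) {p : USphere (m + 1)}
    (h : spaceFormInfDist (spaceFormProj Γ p) (cutLocus x₀) ≤ R) :
    r / 2 - R ≤ sphereDist p₀ p := by
  refine le_of_forall_pos_lt_add fun ε hε => ?_
  have hne : (cutLocus x₀).Nonempty := hp₀ ▸ cutLocus_nonempty p₀
  obtain ⟨_, ⟨y, hy, rfl⟩, hlt⟩ := exists_lt_of_csInf_lt (hne.image _)
    (lt_of_le_of_lt h (by linarith : R < R + ε))
  obtain ⟨q, v, t, hq, ht, rfl⟩ := hy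
  have h1 : r / 2 ≤ t := ht.2 ⟨by linarith, spaceFormDist_sphereGeodesic hp₀ hr hq v
    (by linarith) (by linarith) le_rfl⟩
  have h2 := ht.1.2
  have h3 := spaceFormDist_triangle x₀ (spaceFormProj Γ p)
    (spaceFormProj Γ (sphereGeodesic q v t))
  have h4 := spaceFormDist_le (Γ := Γ) p₀ p
  rw [hp₀] at h4
  simp only at hlt
  linarith

end Distance

/-! ### Local homeomorphisms -/

section LocalHomeomorph

/-- A continuous map that near every point of its source has a continuous local inverse is a
local homeomorphism. -/
theorem IsLocalHomeomorph.of_local_sections {X Y : Type*} [TopologicalSpace X]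
    [TopologicalSpace Y] {q : X → Y} (hq : Continuous q)
    (h : ∀ z : X, ∃ (U : Set Y) (s : Y → X), IsOpen U ∧ q z ∈ U ∧ ContinuousOn s U ∧
      (∀ y ∈ U, q (s y) = y) ∧ ∀ᶠ z' in 𝓝 z, s (q z') = z') :
    IsLocalHomeomorph q := by
  refine IsLocalHomeomorph.mk _ fun z => ?_
  obtain ⟨U, s, hU, hzU, hs, hqs, hsq⟩ := h z
  obtain ⟨W, hW, hWo, hzW⟩ := eventually_nhds_iff.1 hsq
  refine ⟨{ toFun := q, invFun := s, source := W ∩ q ⁻¹' U, target := U ∩ s ⁻¹' W,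
            map_source' := fun x hx => ⟨hx.2, by
              rw [Set.mem_preimage, hW x hx.1]; exact hx.1⟩
            map_target' := fun y hy => ⟨hy.2, by rw [Set.mem_preimage, hqs y hy.1]; exact hy.1⟩
            left_inv' := fun x hx => hW x hx.1
            right_inv' := fun y hy => hqs y hy.1
            open_source := hWo.inter (hU.preimage hq)
            open_target := hs.isOpen_inter_preimage hU hWo
            continuousOn_toFun := hq.continuousOn
            continuousOn_invFun := hs.mono Set.inter_subset_left }, ⟨hzW, hzU⟩, fun _ _ => rfl⟩

/-- A space with a local homeomorphism to a locally connected space is locally connected. -/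
theorem IsLocalHomeomorph.locallyConnectedSpace {X Y : Type*} [TopologicalSpace X]
    [TopologicalSpace Y] [LocallyConnectedSpace Y] {q : X → Y} (hq : IsLocalHomeomorph q) :
    LocallyConnectedSpace X := by
  choose e he _ using hq
  let _ : ChartedSpace Y X :=
    { atlas := Set.univ
      chartAt := e
      mem_chart_source := he
      chart_mem_atlas := fun _ => Set.mem_univ _ }
  exact ChartedSpace.locallyConnectedSpace Y X

variable {n : ℕ}

theorem exists_ne_and_ne_neg (hn : 1 ≤ n) (a : USphere n) : ∃ v : USphere n, v ≠ a ∧ v ≠ -a := by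
  have hinf : ({a, -a} : Set (USphere n)) ≠ Set.univ := by
    intro h
    have hpc : IsConnected (Metric.sphere (0 : EuclideanSpace ℝ (Fin (n + 1))) 1) := by
      refine isConnected_sphere ?_ 0 zero_le_one
      rw [← Module.finrank_eq_rank]
      simp only [finrank_euclideanSpace, Fintype.card_fin]
      exact_mod_cast (by omega : 1 < n + 1)
    have : ConnectedSpace (USphere n) := isConnected_iff_connectedSpace.1 hpc
    have hf : Finite (USphere n) := Set.finite_univ_iff.1 (h ▸ Set.toFinite _)
    have : Subsingleton (USphere n) := PreconnectedSpace.trivial_of_discrete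
    exact ne_neg_of_mem_unit_sphere ℝ a (Subsingleton.elim _ _)
  obtain ⟨v, hv⟩ := (Set.ne_univ_iff_exists_notMem _).1 hinf
  simp only [Set.mem_insert_iff, Set.mem_singleton_iff, not_or] at hv
  exact ⟨v, hv⟩

/-- For `n ≥ 2` the complement of two antipodal points in the `n`-sphere is connected. -/
theorem isPreconnected_compl_antipodal (hn : 2 ≤ n) (v : USphere n) :
    IsPreconnected ({v}ᶜ ∩ {-v}ᶜ : Set (USphere n)) := by
  have hv : ‖(v : EuclideanSpace ℝ (Fin (n + 1)))‖ = 1 := norm_eq_of_mem_sphere v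
  have : Fact (Module.finrank ℝ (EuclideanSpace ℝ (Fin (n + 1))) = n + 1) := ⟨by simp⟩
  have hfr := Submodule.finrank_orthogonal_span_singleton (𝕜 := ℝ) (n := n)
    (ne_zero_of_mem_unit_sphere v)
  have hc : IsConnected ({0}ᶜ : Set (ℝ ∙ (v : EuclideanSpace ℝ (Fin (n + 1))))ᗮ) := by
    refine isConnected_compl_singleton_of_one_lt_rank ?_ 0
    rw [← Module.finrank_eq_rank, hfr]
    exact_mod_cast hn
  have himg : (stereographic hv).symm '' {0}ᶜ = ({v}ᶜ ∩ {-v}ᶜ : Set (USphere n)) := by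
    have hsrc := stereographic_source hv
    have h0 : stereographic hv (-v) = 0 := stereographic_apply_neg v
    ext y
    constructor
    · rintro ⟨w, hw, rfl⟩
      have h1 : (stereographic hv).symm w ∈ (stereographic hv).source :=
        (stereographic hv).map_target (by simp)
      refine ⟨by rwa [hsrc] at h1, fun h2 => hw ?_⟩
      have h2 : (stereographic hv).symm w = -v := h2
      have h3 := (stereographic hv).right_inv (x := w) (by simp)
      rw [h2, h0] at h3
      exact h3.symm
    · rintro ⟨h1, h2⟩
      have h1' : y ∈ (stereographic hv).source := by rw [hsrc]; exact h1
      refine ⟨stereographic hv y, fun h3 => h2 ?_, (stereographic hv).left_inv h1'⟩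
      have h4 : (-v) ∈ (stereographic hv).source := by
        rw [hsrc]
        exact fun h => absurd h (by
          have := ne_neg_of_mem_unit_sphere ℝ v
          exact fun h => this h.symm)
      exact (stereographic hv).injOn h1' h4 (h3.trans h0.symm)
  rw [← himg]
  exact hc.isPreconnected.image _
    ((stereographic hv).continuousOn_symm.mono (by simp))

/-- Over the complement of a point of the sphere, a local homeomorphism from a compact space has
a section through every given point. -/
theorem IsLocalHomeomorph.exists_section_compl_singleton {X : Type*} [TopologicalSpace X]
    [T2Space X] [CompactSpace X] {g : X → USphere n} (hg : IsLocalHomeomorph g) (v : USphere n)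
    (x : X) (hx : g x ≠ v) :
    ∃ s : USphere n → X, ContinuousOn s {v}ᶜ ∧ (∀ y ≠ v, g (s y) = y) ∧ s (g x) = x := by
  have hv : ‖(v : EuclideanSpace ℝ (Fin (n + 1)))‖ = 1 := norm_eq_of_mem_sphere v
  have hsrc := stereographic_source hv
  have hsrc' : (stereographic hv).source = {v}ᶜ := hsrc
  have hcont : Continuous (stereographic hv).symm := by
    rw [← continuousOn_univ, ← stereographic_target hv]
    exact (stereographic hv).continuousOn_symm
  have hcov : IsCoveringMap g := isLocalHomeomorph_iff_isCoveringMap.1 hg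
  have hinv : ∀ y ≠ v, (stereographic hv).symm (stereographic hv y) = y := fun y hy =>
    (stereographic hv).left_inv (by rw [hsrc']; exact hy)
  obtain ⟨F, ⟨hF0, hF⟩, -⟩ := hcov.existsUnique_continuousMap_lifts
    ⟨(stereographic hv).symm, hcont⟩ (stereographic hv (g x)) x (hinv _ hx).symm
  refine ⟨fun y => F (stereographic hv y), ?_, fun y hy => ?_, hF0⟩
  · rw [← hsrc']
    exact F.continuous.comp_continuousOn (stereographic hv).continuousOn
  · exact (congrFun hF _).trans (hinv y hy)

/-- The `n`-sphere with `n ≥ 2` has no nontrivial connected coverings: a local homeomorphism onto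
it from a compact connected Hausdorff space is injective. The sections over the complements of
two antipodal points agree on the overlap, which is connected, and glue to a global section, whose
range is clopen. -/
theorem IsLocalHomeomorph.bijective_of_sphere (hn : 2 ≤ n) {X : Type*} [TopologicalSpace X]
    [T2Space X] [CompactSpace X] [ConnectedSpace X] {g : X → USphere n}
    (hg : IsLocalHomeomorph g) : Function.Bijective g := by
  obtain ⟨x⟩ := (inferInstance : Nonempty X)
  have hcov : IsCoveringMap g := isLocalHomeomorph_iff_isCoveringMap.1 hg
  obtain ⟨v, hvx, hvx'⟩ : ∃ v : USphere n, g x ≠ v ∧ g x ≠ -v := by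
    obtain ⟨v, hv⟩ := exists_ne_and_ne_neg (by omega : 1 ≤ n) (g x)
    refine ⟨v, fun h => hv.1 h.symm, fun h => hv.2 ?_⟩
    rw [h, neg_neg]
  obtain ⟨s, hs, hgs, hsx⟩ := hg.exists_section_compl_singleton v x hvx
  obtain ⟨t, ht, hgt, htx⟩ := hg.exists_section_compl_singleton (-v) x hvx'
  have heq : Set.EqOn s t ({v}ᶜ ∩ {-v}ᶜ) := by
    refine hcov.eqOn_of_comp_eqOn (isPreconnected_compl_antipodal hn v)
      (hs.mono Set.inter_subset_left) (ht.mono Set.inter_subset_right) (fun y hy => ?_)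
      (a := g x) ⟨hvx, hvx'⟩ (hsx.trans htx.symm)
    exact (hgs y hy.1).trans (hgt y hy.2).symm
  classical
  let σ : USphere n → X := fun y => if y = v then t y else s y
  have hσs : Set.EqOn σ s {v}ᶜ := fun y hy => if_neg hy
  have hσt : Set.EqOn σ t {-v}ᶜ := fun y hy => by
    by_cases h : y = v
    · exact if_pos h
    · exact (if_neg h).trans (heq ⟨h, hy⟩)
  have hvne : v ≠ -v := ne_neg_of_mem_unit_sphere ℝ v
  have hσ : Continuous σ := by
    rw [continuous_iff_continuousAt]
    intro y
    by_cases h : y = v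
    · have hy : ({-v}ᶜ : Set (USphere n)) ∈ 𝓝 y :=
        isOpen_compl_singleton.mem_nhds (by rw [h]; exact hvne)
      exact (ht.congr hσt).continuousAt hy
    · exact (hs.congr hσs).continuousAt (isOpen_compl_singleton.mem_nhds h)
  have hgσ : ∀ y, g (σ y) = y := fun y => by
    by_cases h : y = v
    · rw [hσt (by rw [h]; exact hvne)]
      exact hgt y (by rw [h]; exact hvne)
    · rw [hσs h]
      exact hgs y h
  have hopen : IsOpenMap σ := (IsLocalHomeomorph.of_comp (f := σ) (g := g) (by
    rw [show g ∘ σ = id from funext hgσ]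
    exact (Homeomorph.refl _).isLocalHomeomorph) hg hσ).isOpenMap
  have huniv : Set.range σ = Set.univ :=
    IsClopen.eq_univ ⟨(isCompact_range hσ).isClosed, hopen.isOpen_range⟩ ⟨σ v, v, rfl⟩
  have hsurj : Function.Surjective σ := Set.range_eq_univ.1 huniv
  refine ⟨fun a b hab => ?_, fun y => ⟨_, hgσ y⟩⟩
  obtain ⟨a, rfl⟩ := hsurj a
  obtain ⟨b, rfl⟩ := hsurj b
  rw [hgσ, hgσ] at hab
  rw [hab]

end LocalHomeomorph

/-! ### Unit normals to a family of hyperplanes -/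

section NormalField

variable {X F E : Type*} [NormedAddCommGroup X] [NormedSpace ℝ X]
  [NormedAddCommGroup F] [NormedSpace ℝ F] [FiniteDimensional ℝ F]
  [NormedAddCommGroup E] [InnerProductSpace ℝ E] [FiniteDimensional ℝ E]

/-- The range of a linear map into a space of one dimension more has a unit normal. -/
theorem exists_unit_normal (hdim : Module.finrank ℝ E = Module.finrank ℝ F + 1)
    (B : F →L[ℝ] E) : ∃ ζ : E, ‖ζ‖ = 1 ∧ ∀ w, inner ℝ ζ (B w) = 0 := by
  have h1 := Submodule.finrank_add_finrank_orthogonal (LinearMap.range (B : F →ₗ[ℝ] E))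
  have h2 := LinearMap.finrank_range_le (B : F →ₗ[ℝ] E)
  have : Nontrivial (LinearMap.range (B : F →ₗ[ℝ] E))ᗮ :=
    Module.nontrivial_of_finrank_pos (R := ℝ) (by omega)
  obtain ⟨ζ, hζ⟩ := exists_norm_eq (LinearMap.range (B : F →ₗ[ℝ] E))ᗮ (zero_le_one (α := ℝ))
  refine ⟨ζ, hζ, fun w => ?_⟩
  exact Submodule.inner_left_of_mem_orthogonal (K := LinearMap.range (B : F →ₗ[ℝ] E))
    ⟨w, rfl⟩ ζ.2

/-- A smooth family `B u` of linear maps into a space of one dimension more has, near a parameter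
at which it is injective, a smooth unit normal field extending a given normal; every unit normal
agrees with it up to sign. The field is the normalised Riesz representative of the
`η₀`-component of the inverse of `(w, s) ↦ B u w + s • η₀`. -/
theorem exists_normal_field (hdim : Module.finrank ℝ E = Module.finrank ℝ F + 1)
    {B : X → F →L[ℝ] E} {S : Set X} (hS : IsOpen S) (hB : ContDiffOn ℝ ∞ B S) {u₀ : X}
    (hu₀ : u₀ ∈ S) (hinj : Function.Injective (B u₀)) {η₀ : E} (hη₀ : ‖η₀‖ = 1)
    (horth : ∀ w, inner ℝ η₀ (B u₀ w) = 0) :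
    ∃ (W : Set X) (N : X → E), IsOpen W ∧ u₀ ∈ W ∧ W ⊆ S ∧ ContDiffOn ℝ ∞ N W ∧ N u₀ = η₀ ∧
      ∀ u ∈ W, ‖N u‖ = 1 ∧ (∀ w, inner ℝ (N u) (B u w) = 0) ∧
        ∀ ζ : E, ‖ζ‖ = 1 → (∀ w, inner ℝ ζ (B u w) = 0) → ζ = N u ∨ ζ = -N u := by
  have : CompleteSpace F := FiniteDimensional.complete ℝ F
  let L : X → (F × ℝ) →L[ℝ] E := fun u => (B u).coprod (ContinuousLinearMap.toSpanSingleton ℝ η₀)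
  have hLapp : ∀ u w s, L u (w, s) = B u w + s • η₀ := fun u w s => by simp [L]
  have hL : ContDiffOn ℝ ∞ L S := by
    have h : L = fun u => B u ∘L ContinuousLinearMap.fst ℝ F ℝ +
        ContinuousLinearMap.toSpanSingleton ℝ η₀ ∘L ContinuousLinearMap.snd ℝ F ℝ := by
      ext u : 1
      ext <;> simp [L]
    rw [h]
    exact (hB.clm_comp contDiffOn_const).add contDiffOn_const
  let R : Set ((F × ℝ) →L[ℝ] E) := Set.range ((↑) : ((F × ℝ) ≃L[ℝ] E) → (F × ℝ) →L[ℝ] E)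
  let W : Set X := S ∩ L ⁻¹' R
  have hW : IsOpen W := hL.continuousOn.isOpen_inter_preimage hS ContinuousLinearEquiv.isOpen
  have hu₀W : u₀ ∈ W := by
    refine ⟨hu₀, ?_⟩
    have hLinj : Function.Injective (L u₀ : (F × ℝ) →ₗ[ℝ] E) := by
      rw [← LinearMap.ker_eq_bot, LinearMap.ker_eq_bot']
      rintro ⟨w, s⟩ h
      have h : B u₀ w + s • η₀ = 0 := (hLapp u₀ w s).symm.trans h
      have hs : s = 0 := by
        have := congrArg (fun z => inner ℝ η₀ z) h
        simpa [inner_add_right, horth, inner_smul_right, hη₀] using this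
      rw [hs, zero_smul, add_zero] at h
      rw [hinj (h.trans (map_zero _).symm), hs]
      rfl
    have hfr : Module.finrank ℝ (F × ℝ) = Module.finrank ℝ E := by
      rw [Module.finrank_prod, hdim, Module.finrank_self]
    exact ⟨(LinearEquiv.ofInjectiveOfFinrankEq _ hLinj hfr).toContinuousLinearEquiv, by
      ext <;> rfl⟩
  let b := stdOrthonormalBasis ℝ E
  let ℓ : X → E → ℝ := fun u z => ((L u).inverse z).2
  let N₀ : X → E := fun u => ∑ i, ℓ u (b i) • b i
  have hN₀ : ∀ u z, inner ℝ (N₀ u) z = ℓ u z := by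
    intro u z
    have : ℓ u z = (ContinuousLinearMap.snd ℝ F ℝ ∘L (L u).inverse) z := rfl
    rw [this]
    conv_rhs => rw [← b.sum_repr z]
    simp only [N₀, sum_inner, inner_smul_left, map_sum, map_smul, b.repr_apply_apply]
    refine Finset.sum_congr rfl fun i _ => ?_
    simp [ℓ, mul_comm]
  have hℓ : ∀ u ∈ W, ∀ w s, ℓ u (B u w + s • η₀) = s := by
    rintro u ⟨-, e, he⟩ w s
    rw [← hLapp]
    simp only [ℓ]
    rw [← he, ContinuousLinearMap.inverse_equiv]
    simp
  have hsurj : ∀ u ∈ W, ∀ z, ∃ (w : F) (s : ℝ), z = B u w + s • η₀ := by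
    rintro u ⟨-, e, he⟩ z
    refine ⟨(e.symm z).1, (e.symm z).2, ?_⟩
    rw [← hLapp, ← he]
    simp
  have hN₀B : ∀ u ∈ W, ∀ w, inner ℝ (N₀ u) (B u w) = 0 := fun u hu w => by
    rw [hN₀]
    simpa using hℓ u hu w 0
  have hN₀η : ∀ u ∈ W, inner ℝ (N₀ u) η₀ = 1 := fun u hu => by
    rw [hN₀]
    simpa using hℓ u hu 0 1
  have hne : ∀ u ∈ W, N₀ u ≠ 0 := fun u hu h => by
    have := hN₀η u hu
    simp [h] at this
  have huniq : ∀ u ∈ W, ∀ ζ : E, (∀ w, inner ℝ ζ (B u w) = 0) → ζ = inner ℝ ζ η₀ • N₀ u := by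
    intro u hu ζ hζ
    refine ext_inner_right ℝ fun z => ?_
    obtain ⟨w, s, rfl⟩ := hsurj u hu z
    rw [inner_smul_left, hN₀, hℓ u hu, inner_add_right, hζ, inner_smul_right]
    simp [mul_comm]
  have hN₀s : ContDiffOn ℝ ∞ N₀ W := by
    refine ContDiffOn.sum fun i _ => ContDiffOn.smul ?_ contDiffOn_const
    have hinv : ContDiffOn ℝ ∞ (fun u => (L u).inverse) W := by
      rintro u ⟨hu, e, he⟩
      refine ContDiffAt.comp_contDiffWithinAt (g := ContinuousLinearMap.inverse) u ?_
        ((hL u hu).mono Set.inter_subset_left)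
      rw [← he]
      exact contDiffAt_map_inverse e
    exact contDiff_snd.comp_contDiffOn (hinv.clm_apply contDiffOn_const)
  refine ⟨W, fun u => ‖N₀ u‖⁻¹ • N₀ u, hW, hu₀W, Set.inter_subset_left, ?_, ?_, ?_⟩
  · exact ((hN₀s.norm ℝ hne).inv fun u hu => norm_ne_zero_iff.2 (hne u hu)).smul hN₀s
  · have h : N₀ u₀ = η₀ := by
      have := huniq u₀ hu₀W η₀ horth
      rw [real_inner_self_eq_norm_sq, hη₀] at this
      simpa using this.symm
    simp [h, hη₀]
  · intro u hu
    refine ⟨norm_smul_inv_norm (hne u hu), fun w => ?_, fun ζ hζ hζB => ?_⟩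
    · rw [inner_smul_left, hN₀B u hu, mul_zero]
    · have h := huniq u hu ζ hζB
      have h1 : |inner ℝ ζ η₀| * ‖N₀ u‖ = 1 := by
        rw [← Real.norm_eq_abs, ← norm_smul, ← h, hζ]
      rcases abs_choice (inner ℝ ζ η₀ : ℝ) with h2 | h2
      · left
        rw [h2] at h1
        change ζ = ‖N₀ u‖⁻¹ • N₀ u
        rw [← eq_inv_of_mul_eq_one_left h1]
        exact h
      · right
        rw [h2] at h1
        change ζ = -(‖N₀ u‖⁻¹ • N₀ u)
        rw [← eq_inv_of_mul_eq_one_left h1, ← neg_smul, neg_neg]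
        exact h

end NormalField

/-! ### The inverse function theorem on manifolds -/

section InverseFunction

variable {V : Type*} [NormedAddCommGroup V] [NormedSpace ℝ V]
  {M N : Type*} [TopologicalSpace M] [ChartedSpace V M] [IsManifold 𝓘(ℝ, V) ∞ M]
  [TopologicalSpace N] [ChartedSpace V N] [IsManifold 𝓘(ℝ, V) ∞ N]

/-- The restriction of a partial diffeomorphism to an open subset of its source. -/
def PartialDiffeomorph.restrOpen {M N : Type*} [TopologicalSpace M] [ChartedSpace V M]
    [TopologicalSpace N] [ChartedSpace V N]
    (Φ : PartialDiffeomorph 𝓘(ℝ, V) 𝓘(ℝ, V) M N ∞) (S : Set M) (hS : IsOpen S) :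
    PartialDiffeomorph 𝓘(ℝ, V) 𝓘(ℝ, V) M N ∞ where
  toPartialEquiv := (Φ.toOpenPartialHomeomorph.restrOpen S hS).toPartialEquiv
  open_source := (Φ.toOpenPartialHomeomorph.restrOpen S hS).open_source
  open_target := (Φ.toOpenPartialHomeomorph.restrOpen S hS).open_target
  contMDiffOn_toFun := Φ.contMDiffOn_toFun.mono Set.inter_subset_left
  contMDiffOn_invFun := Φ.contMDiffOn_invFun.mono Set.inter_subset_left

theorem IsLocalDiffeomorphAt.congr_of_eventuallyEq {M N : Type*} [TopologicalSpace M]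
    [ChartedSpace V M] [TopologicalSpace N] [ChartedSpace V N] {f g : M → N} {x : M}
    (hf : IsLocalDiffeomorphAt 𝓘(ℝ, V) 𝓘(ℝ, V) ∞ f x) (h : f =ᶠ[𝓝 x] g) :
    IsLocalDiffeomorphAt 𝓘(ℝ, V) 𝓘(ℝ, V) ∞ g x := by
  obtain ⟨Φ, hx, hΦ⟩ := hf
  obtain ⟨S, hS, hSo, hxS⟩ := eventually_nhds_iff.1 h
  exact ⟨Φ.restrOpen S hSo, ⟨hx, hxS⟩, fun y hy => (hS y hy.2).symm.trans (hΦ hy.1)⟩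

/-- A chart as a partial diffeomorphism to the model space. -/
def chartPartialDiffeomorph (x : M) : PartialDiffeomorph 𝓘(ℝ, V) 𝓘(ℝ, V) M V ∞ where
  toPartialEquiv := (chartAt V x).toPartialEquiv
  open_source := (chartAt V x).open_source
  open_target := (chartAt V x).open_target
  contMDiffOn_toFun := contMDiffOn_chart
  contMDiffOn_invFun := contMDiffOn_chart_symm

variable [FiniteDimensional ℝ V]

/-- The inverse function theorem in a normed space, as a statement on local diffeomorphisms. -/
theorem isLocalDiffeomorphAt_of_injective_fderiv {h : V → V} {O : Set V} (hO : IsOpen O)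
    (hh : ContDiffOn ℝ ∞ h O) {a : V} (ha : a ∈ O) (hinj : Function.Injective (fderiv ℝ h a)) :
    IsLocalDiffeomorphAt 𝓘(ℝ, V) 𝓘(ℝ, V) ∞ h a := by
  have : CompleteSpace V := FiniteDimensional.complete ℝ V
  have hat : ∀ u ∈ O, ContDiffAt ℝ ∞ h u := fun u hu => hh.contDiffAt (hO.mem_nhds hu)
  let R : Set (V →L[ℝ] V) := Set.range ((↑) : (V ≃L[ℝ] V) → V →L[ℝ] V)
  let e : V ≃L[ℝ] V :=
    (LinearEquiv.ofInjectiveEndo (fderiv ℝ h a : V →ₗ[ℝ] V) hinj).toContinuousLinearEquiv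
  have he : (e : V →L[ℝ] V) = fderiv ℝ h a := by ext; rfl
  have hO' : IsOpen (O ∩ fderiv ℝ h ⁻¹' R) :=
    (hh.continuousOn_fderiv_of_isOpen hO (by simp)).isOpen_inter_preimage hO
      ContinuousLinearEquiv.isOpen
  have hd : HasFDerivAt h (e : V →L[ℝ] V) a := by
    rw [he]
    exact ((hat a ha).differentiableAt (by simp)).hasFDerivAt
  let k := (hat a ha).toOpenPartialHomeomorph h hd (by simp)
  have hk : ∀ u, k u = h u := fun u => rfl
  let k' := k.restrOpen _ hO'
  refine ⟨{ toPartialEquiv := k'.toPartialEquiv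
            open_source := k'.open_source
            open_target := k'.open_target
            contMDiffOn_toFun := ?_
            contMDiffOn_invFun := ?_ }, ⟨?_, ha, e, he⟩, fun u _ => rfl⟩
  · exact contMDiffOn_iff_contDiffOn.2 (hh.mono fun u hu => hu.2.1)
  · refine contMDiffOn_iff_contDiffOn.2 fun w hw => ContDiffAt.contDiffWithinAt ?_
    have hw' := k'.map_target hw
    obtain ⟨-, hwO, e', he'⟩ := hw'
    refine k'.contDiffAt_symm (f₀' := e') hw ?_ (hat _ hwO)
    rw [he']
    exact ((hat _ hwO).differentiableAt (by simp)).hasFDerivAt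
  · exact ContDiffAt.mem_toOpenPartialHomeomorph_source _ _ _

/-- The inverse function theorem for maps between manifolds of the same dimension. -/
theorem isLocalDiffeomorphAt_of_injective_mfderiv {g : M → N} {S : Set M} (hS : IsOpen S)
    (hg : ContMDiffOn 𝓘(ℝ, V) 𝓘(ℝ, V) ∞ g S) {x : M} (hx : x ∈ S)
    (hinj : Function.Injective (mfderiv 𝓘(ℝ, V) 𝓘(ℝ, V) g x)) :
    IsLocalDiffeomorphAt 𝓘(ℝ, V) 𝓘(ℝ, V) ∞ g x := by
  let c := chartAt V x
  let d := chartAt V (g x)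
  let h : V → V := d ∘ g ∘ c.symm
  have hSd : IsOpen (S ∩ g ⁻¹' d.source) := hg.continuousOn.isOpen_inter_preimage hS d.open_source
  have hO : IsOpen (c.target ∩ c.symm ⁻¹' (S ∩ g ⁻¹' d.source)) :=
    c.continuousOn_symm.isOpen_inter_preimage c.open_target hSd
  have hxc : x ∈ c.source := mem_chart_source V x
  have hcx : c x ∈ c.target ∩ c.symm ⁻¹' (S ∩ g ⁻¹' d.source) := by
    refine ⟨c.map_source hxc, ?_⟩
    rw [Set.mem_preimage, c.left_inv hxc]
    exact ⟨hx, mem_chart_source V (g x)⟩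
  have hh : ContDiffOn ℝ ∞ h (c.target ∩ c.symm ⁻¹' (S ∩ g ⁻¹' d.source)) := by
    rw [← contMDiffOn_iff_contDiffOn]
    refine ContMDiffOn.comp (t := d.source) contMDiffOn_chart
      (ContMDiffOn.comp (t := S) hg (contMDiffOn_chart_symm.mono Set.inter_subset_left)
        fun u hu => hu.2.1) fun u hu => hu.2.2
  have hmd : MDifferentiableAt 𝓘(ℝ, V) 𝓘(ℝ, V) g x :=
    (hg.contMDiffAt (hS.mem_nhds hx)).mdifferentiableAt (by simp)
  obtain ⟨A, hA⟩ : ∃ A : V →L[ℝ] V, A = mfderiv 𝓘(ℝ, V) 𝓘(ℝ, V) g x := ⟨_, rfl⟩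
  have hfd : HasFDerivAt h A (c x) := by
    have key : HasFDerivWithinAt (writtenInExtChartAt 𝓘(ℝ, V) 𝓘(ℝ, V) x g) A
        (Set.range 𝓘(ℝ, V)) (extChartAt 𝓘(ℝ, V) x x) := by
      rw [hA]
      exact hmd.hasMFDerivAt.2
    rw [← hasFDerivWithinAt_univ]
    simpa [writtenInExtChartAt, extChartAt] using key
  have hAinj : Function.Injective A := by rw [hA]; exact hinj
  have hloc : IsLocalDiffeomorphAt 𝓘(ℝ, V) 𝓘(ℝ, V) ∞ h (c x) :=
    isLocalDiffeomorphAt_of_injective_fderiv hO hh hcx (by rwa [hfd.fderiv])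
  have h1 : IsLocalDiffeomorphAt 𝓘(ℝ, V) 𝓘(ℝ, V) ∞ c x :=
    ⟨chartPartialDiffeomorph x, hxc, fun _ _ => rfl⟩
  have hhx : h (c x) = d (g x) := by simp [h, c.left_inv hxc]
  have h2 : IsLocalDiffeomorphAt 𝓘(ℝ, V) 𝓘(ℝ, V) ∞ d.symm (h (c x)) := by
    rw [hhx]
    exact ⟨(chartPartialDiffeomorph (g x)).symm, d.map_source (mem_chart_source V (g x)),
      fun _ _ => rfl⟩
  refine ((h1.comp (hg := hloc)).comp (hg := h2)).congr_of_eventuallyEq ?_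
  filter_upwards [hSd.mem_nhds ⟨hx, mem_chart_source V (g x)⟩, c.open_source.mem_nhds hxc]
    with y hy hyc
  simp only [Function.comp_apply, h, c.left_inv hyc]
  exact d.left_inv hy.2

end InverseFunction

/-! ### Smooth maps into the sphere and isometries of the sphere -/

section SphereMaps

variable {H : Type*} [TopologicalSpace H] {V : Type*} [NormedAddCommGroup V] [NormedSpace ℝ V]
  {I : ModelWithCorners ℝ V H} {M : Type*} [TopologicalSpace M] [ChartedSpace H M] {m : ℕ}

/-- Smoothness of a map into the sphere can be tested in the ambient Euclidean space. -/
theorem contMDiffOn_of_coe_sphere {g : M → USphere m} {S : Set M}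
    (hg : ContMDiffOn I 𝓘(ℝ, EuclideanSpace ℝ (Fin (m + 1))) ∞
      (fun y => (g y : EuclideanSpace ℝ (Fin (m + 1)))) S) :
    ContMDiffOn I (𝓡 m) ∞ g S := by
  intro x hx
  rw [contMDiffWithinAt_iff_target]
  refine ⟨Topology.IsInducing.subtypeVal.continuousWithinAt_iff.2 (hg x hx).continuousWithinAt,
    ?_⟩
  have : Fact (Module.finrank ℝ (EuclideanSpace ℝ (Fin (m + 1))) = m + 1) := ⟨by simp⟩
  let w : EuclideanSpace ℝ (Fin (m + 1)) := (-(g x) : USphere m)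
  let J : _ ≃ₗᵢ[ℝ] _ := (OrthonormalBasis.fromOrthogonalSpanSingleton (𝕜 := ℝ)
    m (ne_zero_of_mem_unit_sphere (-(g x)))).repr
  have hmem : (g x : EuclideanSpace ℝ (Fin (m + 1))) ∈
      {z : EuclideanSpace ℝ (Fin (m + 1)) | inner ℝ w z ≠ (1 : ℝ)} := by
    have h : inner ℝ w (g x : EuclideanSpace ℝ (Fin (m + 1))) = -1 := by
      simp [w, inner_neg_left]
    rw [Set.mem_ofPred_eq, h]
    norm_num
  have hopen : IsOpen {z : EuclideanSpace ℝ (Fin (m + 1)) | inner ℝ w z ≠ (1 : ℝ)} :=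
    isOpen_ne_fun (by fun_prop) continuous_const
  have h1 : ContDiffAt ℝ ∞ (stereoToFun w) (g x : EuclideanSpace ℝ (Fin (m + 1))) :=
    contDiffOn_stereoToFun.contDiffAt (hopen.mem_nhds hmem)
  have h2 : ContDiffAt ℝ ∞ (fun z => J (stereoToFun w z))
      (g x : EuclideanSpace ℝ (Fin (m + 1))) :=
    J.contDiff.contDiffAt.comp _ h1
  exact ContMDiffAt.comp_contMDiffWithinAt (I' := 𝓘(ℝ, EuclideanSpace ℝ (Fin (m + 1))))
    (f := fun y => (g y : EuclideanSpace ℝ (Fin (m + 1)))) x h2.contMDiffAt (hg x hx)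

/-- An isometry of the sphere is the restriction of a linear map: it maps an orthonormal basis to
an orthonormal basis and preserves the coordinates. -/
theorem exists_linear_extension {Γ : Type*} [Group Γ] [MulAction Γ (USphere m)]
    [IsIsometricSMul Γ (USphere m)] (g : Γ) :
    ∃ T : EuclideanSpace ℝ (Fin (m + 1)) →L[ℝ] EuclideanSpace ℝ (Fin (m + 1)),
      ∀ p : USphere m, ((g • p : USphere m) : EuclideanSpace ℝ (Fin (m + 1))) = T p := by
  let b := EuclideanSpace.basisFun (Fin (m + 1)) ℝ
  let q : Fin (m + 1) → USphere m := fun i => ⟨b i, by simp⟩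
  let v : Fin (m + 1) → EuclideanSpace ℝ (Fin (m + 1)) := fun i => (g • q i : USphere m)
  have hv : Orthonormal ℝ v := by
    rw [orthonormal_iff_ite]
    intro i j
    simp only [v]
    rw [inner_smul_smul]
    exact orthonormal_iff_ite.1 b.orthonormal i j
  let c : OrthonormalBasis (Fin (m + 1)) ℝ (EuclideanSpace ℝ (Fin (m + 1))) :=
    OrthonormalBasis.mk hv (by
      rw [hv.linearIndependent.span_eq_top_of_card_eq_finrank (by simp)])
  have hc : ∀ i, c i = v i := fun i => by simp [c]
  refine ⟨LinearMap.toContinuousLinearMap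
    (b.toBasis.constr ℝ v : EuclideanSpace ℝ (Fin (m + 1)) →ₗ[ℝ] _), fun p => ?_⟩
  rw [← c.sum_repr (g • p : USphere m)]
  simp only [LinearMap.coe_toContinuousLinearMap', Module.Basis.constr_apply_fintype]
  refine Finset.sum_congr rfl fun i _ => ?_
  rw [c.repr_apply_apply, hc]
  congr 1
  simp only [v]
  rw [inner_smul_smul]
  simp [q, b, EuclideanSpace.inner_single_left]

theorem contMDiff_smul_sphere {Γ : Type*} [Group Γ] [MulAction Γ (USphere m)]
    [IsIsometricSMul Γ (USphere m)] (g : Γ) :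
    ContMDiff (𝓡 m) (𝓡 m) ∞ (fun p : USphere m => g • p) := by
  obtain ⟨T, hT⟩ := exists_linear_extension (m := m) g
  rw [← contMDiffOn_univ]
  refine contMDiffOn_of_coe_sphere ?_
  simp only [hT]
  have : Fact (Module.finrank ℝ (EuclideanSpace ℝ (Fin (m + 1))) = m + 1) := ⟨by simp⟩
  exact (T.contDiff.contMDiff.comp contMDiff_coe_sphere).contMDiffOn

end SphereMaps

/-! ### Local lifts of an immersion to the sphere -/

section LocalLift

variable {m : ℕ} {Γ : Type*} [Group Γ] [MulAction Γ (USphere m)]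
    [IsIsometricSMul Γ (USphere m)] [ActsProperlyDiscontinuously Γ (USphere m)]

theorem isQuotientCoveringMap_spaceFormProj :
    IsQuotientCoveringMap (spaceFormProj Γ (m := m)) Γ :=
  isQuotientCoveringMap_quotientMk_of_properlyDiscontinuousSMul

/-- The charts of the space form are those of the sphere, composed with local inverses of the
projection. -/
theorem exists_chartAt_spaceForm (y : SpaceForm Γ m) :
    ∃ (q : USphere m) (σ : OpenPartialHomeomorph (SpaceForm Γ m) (USphere m)),
      chartAt (EuclideanSpace ℝ (Fin m)) y =
        σ.trans (chartAt (EuclideanSpace ℝ (Fin m)) q) ∧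
      y ∈ σ.source ∧ σ y = q ∧ (σ.symm : USphere m → SpaceForm Γ m) = spaceFormProj Γ := by
  have hπ := (isQuotientCoveringMap_spaceFormProj (Γ := Γ) (m := m)).isCoveringMap.isLocalHomeomorph
  have hs : Function.Surjective (spaceFormProj Γ (m := m)) := spaceFormProj_surjective
  refine ⟨hs.hasRightInverse.choose y, hπ.localInverseAt (hs.hasRightInverse.choose y), rfl,
    ?_, ?_, ?_⟩
  · have := hπ.apply_self_mem_localInverseAt_source (x := hs.hasRightInverse.choose y)
    rwa [hs.hasRightInverse.choose_spec y] at this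
  · have := hπ.localInverseAt_apply_self (x := hs.hasRightInverse.choose y)
    rwa [hs.hasRightInverse.choose_spec y] at this
  · exact hπ.localInverseAt_symm _

variable {n : ℕ} {M : Type*} [TopologicalSpace M] [ChartedSpace (EuclideanSpace ℝ (Fin n)) M]
  {ι : M → SpaceForm Γ m}

/-- An immersion into the space form lifts locally, through every point over its value, to a
smooth map into the sphere with a smooth left inverse. -/
theorem exists_local_lift {x : M} (hι : Manifold.IsImmersionAt (𝓡 n) (𝓡 m) ∞ ι x)
    {p : USphere m} (hp : ι x = spaceFormProj Γ p) :
    ∃ (U : Set M) (f : M → USphere m) (l : USphere m → M), IsOpen U ∧ x ∈ U ∧ f x = p ∧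
      (∀ y ∈ U, spaceFormProj Γ (f y) = ι y) ∧ ContMDiffOn (𝓡 n) (𝓡 m) ∞ f U ∧
      ContMDiffAt (𝓡 m) (𝓡 n) ∞ l p ∧ ∀ y ∈ U, l (f y) = y := by
  obtain ⟨q, σ, hc, hyσ, hσq, hσπ⟩ := exists_chartAt_spaceForm (ι x)
  have hπσ : ∀ z ∈ σ.source, spaceFormProj Γ (σ z) = z := fun z hz => by
    rw [← hσπ]
    exact σ.left_inv hz
  have hσπ' : ∀ q' ∈ σ.target, σ (spaceFormProj Γ q') = q' := fun q' hq' => by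
    rw [← hσπ]
    exact σ.right_inv hq'
  obtain ⟨g, rfl⟩ : ∃ g : Γ, g • q = p := by
    rw [← spaceFormProj_eq_iff (Γ := Γ), ← hp, ← hσq, hπσ _ hyσ]
  let s := chartAt (EuclideanSpace ℝ (Fin m)) q
  let c := chartAt (EuclideanSpace ℝ (Fin m)) (ι x)
  have hcs : c = σ.trans s := hc
  let d := hι.domChart
  let k := hι.codChart
  have hdx : x ∈ d.source := hι.mem_domChart_source
  have hcx : ι x ∈ c.source := mem_chart_source _ _
  have hd : d ∈ IsManifold.maximalAtlas (𝓡 n) ∞ M := hι.domChart_mem_maximalAtlas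
  have hk := hι.codChart_mem_maximalAtlas
  have hdk : ∀ y ∈ d.source, ι y ∈ k.source := hι.source_subset_preimage_source
  have hkc : k.symm.trans c ∈ contDiffGroupoid ∞ (𝓡 m) :=
    (hk c (chart_mem_atlas _ _)).1
  have hck : c.symm.trans k ∈ contDiffGroupoid ∞ (𝓡 m) :=
    (hk c (chart_mem_atlas _ _)).2
  have hwr : ∀ y ∈ d.source, k (ι y) = hι.equiv (d y, 0) := by
    intro y hy
    have hmem : d y ∈ (hι.domChart.extend (𝓡 n)).target := by
      simpa [d] using d.map_source hy
    have h := hι.writtenInCharts hmem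
    have h2 : (hι.domChart.extend (𝓡 n)).symm (d y) = y := by
      simpa [d] using d.left_inv hy
    rw [Function.comp_apply, Function.comp_apply, h2] at h
    simpa [k] using h
  let U : Set M := d.source ∩ ι ⁻¹' c.source
  have hU : IsOpen U := hι.continuousOn.isOpen_inter_preimage d.open_source c.open_source
  have hxU : x ∈ U := ⟨hdx, hcx⟩
  have hcσ : ∀ z ∈ c.source, z ∈ σ.source ∧ σ z ∈ s.source ∧ c z = s (σ z) := by
    intro z hz
    rw [hcs, OpenPartialHomeomorph.trans_source] at hz
    exact ⟨hz.1, hz.2, by rw [hcs]; rfl⟩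
  have hcι : ContMDiffOn (𝓡 n) (𝓡 m) ∞ (fun y => c (ι y)) U := by
    have hJ : ContDiff ℝ ∞ fun w : EuclideanSpace ℝ (Fin n) =>
        hι.equiv (w, (0 : hι.complement)) :=
      hι.equiv.contDiff.comp (contDiff_id.prodMk contDiff_const)
    have h1 : ContMDiffOn (𝓡 n) (𝓡 m) ∞ (fun y => hι.equiv (d y, 0)) U :=
      hJ.contMDiff.comp_contMDiffOn
        ((contMDiffOn_of_mem_maximalAtlas hd).mono Set.inter_subset_left)
    refine ((contMDiffOn_of_mem_contDiffGroupoid hkc).comp h1 fun y hy => ?_).congr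
      fun y hy => ?_
    · rw [Set.mem_preimage, ← hwr y hy.1, OpenPartialHomeomorph.trans_source]
      refine ⟨k.map_source (hdk y hy.1), ?_⟩
      rw [Set.mem_preimage, k.left_inv (hdk y hy.1)]
      exact hy.2
    · rw [Function.comp_apply, ← hwr y hy.1, OpenPartialHomeomorph.trans_apply,
        k.left_inv (hdk y hy.1)]
  have hf₀ : ContMDiffOn (𝓡 n) (𝓡 m) ∞ (fun y => σ (ι y)) U := by
    refine ((contMDiffOn_chart_symm (x := q)).comp hcι fun y hy => ?_).congr fun y hy => ?_
    · obtain ⟨-, h2, h3⟩ := hcσ _ hy.2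
      rw [Set.mem_preimage, h3]
      exact s.map_source h2
    · obtain ⟨-, h2, h3⟩ := hcσ _ hy.2
      rw [Function.comp_apply, h3]
      exact (s.left_inv h2).symm
  -- the smooth left inverse is the first coordinate of the straightened immersion
  let l₀ : USphere m → M := fun p => d.symm (hι.equiv.symm (k (spaceFormProj Γ p))).1
  have hl₀f : ∀ y ∈ U, l₀ (σ (ι y)) = y := fun y hy => by
    simp only [l₀]
    rw [hπσ _ (hcσ _ hy.2).1, hwr y hy.1, hι.equiv.symm_apply_apply]
    exact d.left_inv hy.1
  have hπq : spaceFormProj Γ q = ι x := by rw [← hσq, hπσ _ hyσ]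
  have hsq : s q = c (ι x) := by rw [(hcσ _ hcx).2.2, hσq]
  have hkπ : ContMDiffAt (𝓡 m) (𝓡 m) ∞ (fun p => k (spaceFormProj Γ p)) q := by
    have hsrc : s q ∈ (c.symm.trans k).source := by
      rw [hsq, OpenPartialHomeomorph.trans_source]
      refine ⟨c.map_source hcx, ?_⟩
      rw [Set.mem_preimage, c.left_inv hcx]
      exact hdk x hdx
    have h1 : ContMDiffAt (𝓡 m) (𝓡 m) ∞ (c.symm.trans k) (s q) :=
      (contMDiffOn_of_mem_contDiffGroupoid hck).contMDiffAt
        ((c.symm.trans k).open_source.mem_nhds hsrc)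
    have h2 : ContMDiffAt (𝓡 m) (𝓡 m) ∞ s q :=
      (contMDiffOn_chart (x := q)).contMDiffAt
        ((chartAt _ q).open_source.mem_nhds (mem_chart_source _ q))
    refine (h1.comp q h2).congr_of_eventuallyEq ?_
    have hcont : Continuous (spaceFormProj Γ (m := m)) :=
      isQuotientCoveringMap_spaceFormProj.continuous
    have hqσ : q ∈ σ.target := by
      rw [← hσq]
      exact σ.map_source hyσ
    filter_upwards [σ.open_target.mem_nhds hqσ,
      hcont.continuousAt.preimage_mem_nhds (c.open_source.mem_nhds (hπq ▸ hcx))] with p hp1 hp2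
    obtain ⟨-, -, h3⟩ := hcσ _ hp2
    rw [hσπ' p hp1] at h3
    rw [Function.comp_apply, OpenPartialHomeomorph.trans_apply, ← h3, c.left_inv hp2]
  have hl₀ : ContMDiffAt (𝓡 m) (𝓡 n) ∞ l₀ q := by
    have hJ : ContDiff ℝ ∞ fun w : EuclideanSpace ℝ (Fin m) => (hι.equiv.symm w).1 :=
      contDiff_fst.comp hι.equiv.symm.contDiff
    have h1 : ContMDiffAt (𝓡 m) (𝓡 n) ∞
        (fun p => (hι.equiv.symm (k (spaceFormProj Γ p))).1) q :=
      hJ.contMDiff.contMDiffAt.comp q hkπ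
    have hval : (hι.equiv.symm (k (spaceFormProj Γ q))).1 = d x := by
      rw [hπq, hwr x hdx, hι.equiv.symm_apply_apply]
    have h2 : ContMDiffAt (𝓡 n) (𝓡 n) ∞ d.symm
        (hι.equiv.symm (k (spaceFormProj Γ q))).1 := by
      rw [hval]
      exact contMDiffAt_symm_of_mem_maximalAtlas hd (d.map_source hdx)
    exact h2.comp q h1
  refine ⟨U, fun y => g • σ (ι y), fun p => l₀ (g⁻¹ • p), hU, hxU,
    congrArg (g • ·) hσq, fun y hy => ?_, ?_, ?_, fun y hy => ?_⟩
  · rw [spaceFormProj_smul, hπσ _ (hcσ _ hy.2).1]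
  · exact (contMDiff_smul_sphere g).comp_contMDiffOn hf₀
  · refine ContMDiffAt.comp (g • q) (I' := 𝓡 m) (g := l₀) ?_ (contMDiff_smul_sphere g⁻¹ _)
    rw [inv_smul_smul]
    exact hl₀
  · exact (congrArg l₀ (inv_smul_smul g _)).trans (hl₀f y hy)

end LocalLift

/-! ### Oriented local lifts of the hypersurface -/

section OrientedLift

variable {n : ℕ} {M : Type*} [TopologicalSpace M] [ChartedSpace (EuclideanSpace ℝ (Fin n)) M]

variable (n) in
/-- The differential of a map from a manifold to a normed space, read as a continuous linear map
between normed spaces. -/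
def ambientDeriv {E : Type*} [NormedAddCommGroup E] [NormedSpace ℝ E] (g : M → E) (y : M) :
    EuclideanSpace ℝ (Fin n) →L[ℝ] E :=
  mfderiv (𝓡 n) 𝓘(ℝ, E) g y

theorem hasFDerivAt_ambientDeriv {E : Type*} [NormedAddCommGroup E] [NormedSpace ℝ E] {g : M → E}
    {y : M} (hg : MDifferentiableAt (𝓡 n) 𝓘(ℝ, E) g y) :
    HasFDerivAt (g ∘ (extChartAt (𝓡 n) y).symm) (ambientDeriv n g y) (extChartAt (𝓡 n) y y) := by
  have key : HasFDerivWithinAt (writtenInExtChartAt (𝓡 n) 𝓘(ℝ, E) y g) (ambientDeriv n g y)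
      (Set.range (𝓡 n)) (extChartAt (𝓡 n) y y) := hg.hasMFDerivAt.2
  rw [← hasFDerivWithinAt_univ]
  simpa only [writtenInExtChartAt, extChartAt_model_space_eq_id, PartialEquiv.refl_coe,
    Function.id_comp, ModelWithCorners.range_eq_univ] using key

/-- The differential of a vector valued map on a manifold is, up to a linear isomorphism of the
source, the derivative of its expression in a chart. -/
theorem exists_ambientDeriv_eq_fderiv [IsManifold (𝓡 n) ∞ M] {E : Type*} [NormedAddCommGroup E]
    [NormedSpace ℝ E] {g : M → E} (x : M) {y : M} (hy : y ∈ (extChartAt (𝓡 n) x).source)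
    (hg : MDifferentiableAt (𝓡 n) 𝓘(ℝ, E) g y) :
    ∃ A : EuclideanSpace ℝ (Fin n) ≃L[ℝ] EuclideanSpace ℝ (Fin n), ∀ v, ambientDeriv n g y v =
        fderiv ℝ (g ∘ (extChartAt (𝓡 n) x).symm) (extChartAt (𝓡 n) x y) (A v) := by
  obtain ⟨A, hA⟩ := isInvertible_mfderiv_extChartAt (I := 𝓡 n) hy
  refine ⟨A, fun v => ?_⟩
  have hyt : extChartAt (𝓡 n) x y ∈ (extChartAt (𝓡 n) x).target :=
    (extChartAt (𝓡 n) x).map_source hy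
  have hsymm : MDifferentiableAt (𝓡 n) (𝓡 n) (extChartAt (𝓡 n) x).symm
      (extChartAt (𝓡 n) x y) :=
    ((contMDiffOn_extChartAt_symm (n := ∞) x).contMDiffAt
      ((isOpen_extChartAt_target x).mem_nhds hyt)).mdifferentiableAt (by simp)
  have hG : MDifferentiableAt (𝓡 n) 𝓘(ℝ, E) (g ∘ (extChartAt (𝓡 n) x).symm)
      (extChartAt (𝓡 n) x y) := by
    refine MDifferentiableAt.comp (I' := 𝓡 n) _ ?_ hsymm
    rwa [(extChartAt (𝓡 n) x).left_inv hy]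
  have he : MDifferentiableAt (𝓡 n) (𝓡 n) (extChartAt (𝓡 n) x) y :=
    mdifferentiableAt_extChartAt (by simpa using hy)
  have hcomp := mfderiv_comp y (I' := 𝓡 n) hG he
  have heq : (g ∘ (extChartAt (𝓡 n) x).symm) ∘ extChartAt (𝓡 n) x =ᶠ[𝓝 y] g := by
    filter_upwards [(isOpen_extChartAt_source x).mem_nhds hy] with z hz
    simp only [Function.comp_apply]
    rw [(extChartAt (𝓡 n) x).left_inv hz]
  rw [heq.mfderiv_eq] at hcomp
  rw [ambientDeriv, hcomp, mfderiv_eq_fderiv, ← hA]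
  rfl

variable {Γ : Type*} [Group Γ] [MulAction Γ (USphere (n + 1))]

/-- A smooth lift `f`, over the open set `U`, of the hypersurface `ι` to the sphere, together with
a smooth field `η` of unit normals, which are the only ones up to sign. -/
structure IsOrientedLift (ι : M → SpaceForm Γ (n + 1)) (U : Set M) (f : M → USphere (n + 1))
    (η : M → EuclideanSpace ℝ (Fin (n + 2))) : Prop where
  isOpen : IsOpen U
  proj_eq : ∀ y ∈ U, spaceFormProj Γ (f y) = ι y
  contMDiffOn : ContMDiffOn (𝓡 n) (𝓡 (n + 1)) ∞ f U
  contMDiffOn_normal : ContMDiffOn (𝓡 n) 𝓘(ℝ, EuclideanSpace ℝ (Fin (n + 2))) ∞ η U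
  normal : ∀ y ∈ U, IsUnitNormalAt f η y
  eq_or_eq_neg : ∀ y ∈ U, ∀ ζ, IsUnitNormalAt f (fun _ => ζ) y → ζ = η y ∨ ζ = -η y

variable {ι : M → SpaceForm Γ (n + 1)} {U : Set M} {f : M → USphere (n + 1)}
  {η : M → EuclideanSpace ℝ (Fin (n + 2))}

theorem ContMDiffOn.coe_sphere {f : M → USphere (n + 1)}
    (hf : ContMDiffOn (𝓡 n) (𝓡 (n + 1)) ∞ f U) :
    ContMDiffOn (𝓡 n) 𝓘(ℝ, EuclideanSpace ℝ (Fin (n + 2))) ∞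
      (fun y => (f y : EuclideanSpace ℝ (Fin (n + 2)))) U := by
  have : Fact (Module.finrank ℝ (EuclideanSpace ℝ (Fin (n + 2))) = n + 1 + 1) := ⟨by simp⟩
  exact (contMDiff_coe_sphere (E := EuclideanSpace ℝ (Fin (n + 2)))).comp_contMDiffOn hf

theorem isUnitNormalAt_iff {y : M} : IsUnitNormalAt f η y ↔ ‖η y‖ = 1 ∧
    inner ℝ (η y) (f y : EuclideanSpace ℝ (Fin (n + 2))) = 0 ∧
    ∀ v, inner ℝ (η y)
      (ambientDeriv n (fun z => (f z : EuclideanSpace ℝ (Fin (n + 2)))) y v) = 0 :=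
  Iff.rfl

theorem IsUnitNormalAt.neg {y : M} (h : IsUnitNormalAt f η y) :
    IsUnitNormalAt f (fun z => -η z) y := by
  rw [isUnitNormalAt_iff] at h ⊢
  simpa using h

theorem IsOrientedLift.neg (h : IsOrientedLift ι U f η) :
    IsOrientedLift ι U f (fun y => -η y) where
  isOpen := h.isOpen
  proj_eq := h.proj_eq
  contMDiffOn := h.contMDiffOn
  contMDiffOn_normal := h.contMDiffOn_normal.neg
  normal y hy := (h.normal y hy).neg
  eq_or_eq_neg y hy ζ hζ := by
    rw [neg_neg]
    exact (h.eq_or_eq_neg y hy ζ hζ).symm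

/-- The derivative of a map to the sphere is orthogonal to the position vector. -/
theorem inner_ambientDeriv_coe {y : M}
    (hf : MDifferentiableAt (𝓡 n) 𝓘(ℝ, EuclideanSpace ℝ (Fin (n + 2)))
      (fun z => (f z : EuclideanSpace ℝ (Fin (n + 2)))) y) (v : EuclideanSpace ℝ (Fin n)) :
    inner ℝ (f y : EuclideanSpace ℝ (Fin (n + 2)))
      (ambientDeriv n (fun z => (f z : EuclideanSpace ℝ (Fin (n + 2)))) y v) = 0 := by
  have h := hasFDerivAt_ambientDeriv hf
  have h1 := h.inner ℝ h
  have h2 : (fun t => inner ℝ (((fun z => (f z : EuclideanSpace ℝ (Fin (n + 2)))) ∘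
      (extChartAt (𝓡 n) y).symm) t) (((fun z => (f z : EuclideanSpace ℝ (Fin (n + 2)))) ∘
      (extChartAt (𝓡 n) y).symm) t)) = fun _ => (1 : ℝ) := by
    ext t
    simp
  rw [h2] at h1
  have h3 := congrArg (fun T => T v) (h1.unique (hasFDerivAt_const 1 _))
  simp only [ContinuousLinearMap.comp_apply, fderivInnerCLM_apply,
    ContinuousLinearMap.prod_apply, Function.comp_apply, zero_apply,
    extChartAt_to_inv] at h3
  rw [real_inner_comm] at h3
  linarith [real_inner_comm (f y : EuclideanSpace ℝ (Fin (n + 2)))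
    (ambientDeriv n (fun z => (f z : EuclideanSpace ℝ (Fin (n + 2)))) y v)]

variable [IsManifold (𝓡 n) ∞ M]

/-- An immersed hypersurface has an oriented local lift through every point over it. -/
theorem exists_isOrientedLift [IsIsometricSMul Γ (USphere (n + 1))]
    [ActsProperlyDiscontinuously Γ (USphere (n + 1))] {x : M}
    (hι : Manifold.IsImmersionAt (𝓡 n) (𝓡 (n + 1)) ∞ ι x)
    {p : USphere (n + 1)} (hp : ι x = spaceFormProj Γ p) :
    ∃ (U : Set M) (f : M → USphere (n + 1)) (η : M → EuclideanSpace ℝ (Fin (n + 2))),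
      IsOrientedLift ι U f η ∧ x ∈ U ∧ f x = p := by
  have hfact : Fact (Module.finrank ℝ (EuclideanSpace ℝ (Fin (n + 2))) = n + 1 + 1) := ⟨by simp⟩
  obtain ⟨U, f, l, hU, hxU, hfx, hπf, hf, hl, hlf⟩ := exists_local_lift hι hp
  have hg := hf.coe_sphere
  have hgd : ∀ y ∈ U, MDifferentiableAt (𝓡 n) 𝓘(ℝ, EuclideanSpace ℝ (Fin (n + 2)))
      (fun z => (f z : EuclideanSpace ℝ (Fin (n + 2)))) y := fun y hy =>
    (hg.contMDiffAt (hU.mem_nhds hy)).mdifferentiableAt (by simp)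
  have hinj : Function.Injective
      (ambientDeriv n (fun z => (f z : EuclideanSpace ℝ (Fin (n + 2)))) x) := by
    have hfd : MDifferentiableAt (𝓡 n) (𝓡 (n + 1)) f x :=
      (hf.contMDiffAt (hU.mem_nhds hxU)).mdifferentiableAt (by simp)
    have hc : MDifferentiableAt (𝓡 (n + 1)) 𝓘(ℝ, EuclideanSpace ℝ (Fin (n + 2)))
        ((↑) : USphere (n + 1) → EuclideanSpace ℝ (Fin (n + 2))) (f x) :=
      (contMDiff_coe_sphere (m := ∞) _).mdifferentiableAt (by simp)
    have h1 : ambientDeriv n (fun z => (f z : EuclideanSpace ℝ (Fin (n + 2)))) x =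
        (mfderiv (𝓡 (n + 1)) 𝓘(ℝ, EuclideanSpace ℝ (Fin (n + 2)))
        ((↑) : USphere (n + 1) → EuclideanSpace ℝ (Fin (n + 2))) (f x)).comp
        (mfderiv (𝓡 n) (𝓡 (n + 1)) f x) := mfderiv_comp x hc hfd
    have h2 : Function.Injective (mfderiv (𝓡 n) (𝓡 (n + 1)) f x) := by
      have hld : MDifferentiableAt (𝓡 (n + 1)) (𝓡 n) l (f x) := by
        rw [hfx]
        exact hl.mdifferentiableAt (by simp)
      have h3 := mfderiv_comp x hld hfd
      have h4 : l ∘ f =ᶠ[𝓝 x] id := by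
        filter_upwards [hU.mem_nhds hxU] with y hy using hlf y hy
      have h5 : ∀ v : TangentSpace (𝓡 n) x, (mfderiv (𝓡 (n + 1)) (𝓡 n) l (f x))
          (mfderiv (𝓡 n) (𝓡 (n + 1)) f x v) = v := fun v => by
        have h6 := congrArg (fun T => T v) (h3.symm.trans (h4.mfderiv_eq.trans mfderiv_id))
        exact h6
      exact Function.LeftInverse.injective h5
    intro v w hvw
    rw [h1] at hvw
    exact h2 (injective_mvfderiv_subtypeVal_sphere (f x) hvw)
  let e := extChartAt (𝓡 n) x
  let G : EuclideanSpace ℝ (Fin n) → EuclideanSpace ℝ (Fin (n + 2)) :=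
    (fun z => (f z : EuclideanSpace ℝ (Fin (n + 2)))) ∘ e.symm
  let O : Set (EuclideanSpace ℝ (Fin n)) := e.target ∩ e.symm ⁻¹' U
  have hO : IsOpen O :=
    (continuousOn_extChartAt_symm x).isOpen_inter_preimage (isOpen_extChartAt_target x) hU
  have hG : ContDiffOn ℝ ∞ G O := by
    rw [← contMDiffOn_iff_contDiffOn]
    exact hg.comp ((contMDiffOn_extChartAt_symm x).mono Set.inter_subset_left) fun u hu => hu.2
  let B : EuclideanSpace ℝ (Fin n) →
      (EuclideanSpace ℝ (Fin n) × ℝ) →L[ℝ] EuclideanSpace ℝ (Fin (n + 2)) := fun u =>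
    fderiv ℝ G u ∘L ContinuousLinearMap.fst ℝ _ ℝ +
      ContinuousLinearMap.smulRight (ContinuousLinearMap.snd ℝ _ ℝ) (G u)
  have hBapp : ∀ u v (t : ℝ), B u (v, t) = fderiv ℝ G u v + t • G u := fun u v t => rfl
  have hB : ContDiffOn ℝ ∞ B O :=
    ((hG.fderiv_of_isOpen hO (by simp)).clm_comp contDiffOn_const).add
      (contDiffOn_const.smulRight hG)
  have hmem : ∀ y ∈ e.source ∩ U, e y ∈ O ∧ G (e y) = f y := fun y hy => by
    have h := e.left_inv hy.1
    refine ⟨⟨e.map_source hy.1, ?_⟩, ?_⟩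
    · rw [Set.mem_preimage, h]
      exact hy.2
    · simp only [G, Function.comp_apply, h]
  have hxe : x ∈ e.source ∩ U := ⟨mem_extChartAt_source x, hxU⟩
  -- a unit normal of the hypersurface is a unit normal of the range of `B`
  have hnormal : ∀ y ∈ e.source ∩ U, ∀ ζ : EuclideanSpace ℝ (Fin (n + 2)),
      IsUnitNormalAt f (fun _ => ζ) y ↔ ‖ζ‖ = 1 ∧ ∀ w, inner ℝ ζ (B (e y) w) = 0 := by
    intro y hy ζ
    obtain ⟨A, hA⟩ := exists_ambientDeriv_eq_fderiv x hy.1 (hgd y hy.2)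
    rw [isUnitNormalAt_iff]
    refine and_congr_right fun _ => ⟨fun h => ?_, fun h => ⟨?_, fun v => ?_⟩⟩
    · rintro ⟨v, t⟩
      have h2 := h.2 (A.symm v)
      rw [hA, A.apply_symm_apply] at h2
      rw [hBapp, inner_add_right, inner_smul_right, (hmem y hy).2, h.1, mul_zero, add_zero]
      exact h2
    · have h2 := h (0, 1)
      rw [hBapp, map_zero, zero_add, one_smul, (hmem y hy).2] at h2
      exact h2
    · have h2 := h (A v, 0)
      rw [hBapp, zero_smul, add_zero] at h2
      rw [hA]
      exact h2
  have hBinj : Function.Injective (B (e x)) := by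
    rw [injective_iff_map_eq_zero]
    rintro ⟨v, t⟩ h
    have hfd : fderiv ℝ G (e x) =
        ambientDeriv n (fun z => (f z : EuclideanSpace ℝ (Fin (n + 2)))) x :=
      (hasFDerivAt_ambientDeriv (hgd x hxU)).fderiv
    rw [hBapp, hfd, (hmem x hxe).2] at h
    have ht : t = 0 := by
      have h2 := congrArg (fun z => inner ℝ (f x : EuclideanSpace ℝ (Fin (n + 2))) z) h
      simpa [inner_add_right, inner_smul_right, inner_ambientDeriv_coe (hgd x hxU)] using h2
    rw [ht, zero_smul, add_zero] at h
    rw [hinj (h.trans (map_zero _).symm), ht]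
    rfl
  have hdim : Module.finrank ℝ (EuclideanSpace ℝ (Fin (n + 2))) =
      Module.finrank ℝ (EuclideanSpace ℝ (Fin n) × ℝ) + 1 := by simp
  obtain ⟨η₀, hη₀, horth⟩ := exists_unit_normal hdim (B (e x))
  obtain ⟨W, N, hW, hxW, hWO, hN, -, hNW⟩ :=
    exists_normal_field hdim hO hB (hmem x hxe).1 hBinj hη₀ horth
  have hU' : IsOpen (e.source ∩ e ⁻¹' W) :=
    (continuousOn_extChartAt x).isOpen_inter_preimage (isOpen_extChartAt_source x) hW
  have hsub : ∀ y ∈ e.source ∩ e ⁻¹' W, y ∈ e.source ∩ U := fun y hy => by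
    have h := (hWO hy.2).2
    rw [Set.mem_preimage, e.left_inv hy.1] at h
    exact ⟨hy.1, h⟩
  refine ⟨e.source ∩ e ⁻¹' W, f, fun y => N (e y), ⟨hU', fun y hy => hπf y (hsub y hy).2,
    hf.mono fun y hy => (hsub y hy).2, ?_, fun y hy => ?_, fun y hy ζ hζ => ?_⟩,
    ⟨hxe.1, hxW⟩, hfx⟩
  · refine hN.contMDiffOn.comp (t := W) ((contMDiffOn_extChartAt (x := x)).mono ?_)
      fun y hy => hy.2
    intro y hy
    simpa [e] using hy.1
  · have h := hNW (e y) hy.2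
    exact (hnormal y (hsub y hy) (N (e y))).2 ⟨h.1, h.2.1⟩
  · have h := (hnormal y (hsub y hy) ζ).1 hζ
    exact (hNW (e y) hy.2).2.2 ζ h.1 h.2

end OrientedLift

/-! ### The Gauss map -/

section GaussVector

variable {E : Type*} [NormedAddCommGroup E] [InnerProductSpace ℝ E]

/-- The parallel translate, along the great circle from `p` to `-p₀`, of a vector `ζ` tangent to
the sphere at `p`. It is also the normalised image of `ζ` under the differential of the
stereographic projection from `p₀`. -/
def gaussVector (p₀ p ζ : E) : E :=
  ζ + (inner ℝ ζ p₀ / (1 - inner ℝ p p₀)) • (p - p₀)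

theorem gaussVector_neg (p₀ p ζ : E) : gaussVector p₀ p (-ζ) = -gaussVector p₀ p ζ := by
  simp only [gaussVector, inner_neg_left, neg_div, neg_smul, neg_add]

variable {p₀ p ζ : E}

theorem inner_gaussVector (h₀ : ‖p₀‖ = 1) (hp : inner ℝ p p₀ ≠ (1 : ℝ)) :
    inner ℝ (gaussVector p₀ p ζ) p₀ = 0 := by
  have h : (1 : ℝ) - inner ℝ p p₀ ≠ 0 := sub_ne_zero.2 hp.symm
  rw [gaussVector, inner_add_left, inner_smul_left, inner_sub_left, real_inner_self_eq_norm_sq,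
    h₀]
  simp only [conj_trivial]
  field_simp
  ring

theorem norm_gaussVector (h₀ : ‖p₀‖ = 1) (hp1 : ‖p‖ = 1) (hp : inner ℝ p p₀ ≠ (1 : ℝ))
    (hζ : ‖ζ‖ = 1) (hζp : inner ℝ ζ p = 0) : ‖gaussVector p₀ p ζ‖ = 1 := by
  have h : (1 : ℝ) - inner ℝ p p₀ ≠ 0 := sub_ne_zero.2 hp.symm
  have h2 : ‖gaussVector p₀ p ζ‖ ^ 2 = 1 := by
    rw [gaussVector, norm_add_sq_real, norm_smul, mul_pow, norm_sub_sq_real, inner_smul_right,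
      inner_sub_right, hζp, h₀, hp1, hζ, Real.norm_eq_abs, sq_abs]
    field_simp
    ring
  exact (pow_eq_one_iff_of_nonneg (norm_nonneg _) two_ne_zero).1 h2

/-- For unit vectors `p₀`, `p` and `e` with `e ⟂ p₀`, the gradient at `p` of the function
`⟪p, e⟫ / (1 - ⟪p, p₀⟫)` is a multiple of a unit vector whose translate is `e`. -/
theorem exists_gaussVector_eq {e : E} (h₀ : ‖p₀‖ = 1) (hp1 : ‖p‖ = 1)
    (hp : inner ℝ p p₀ ≠ (1 : ℝ)) (he : ‖e‖ = 1) (hep : inner ℝ e p₀ = 0) :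
    ∃ w : E, ‖w‖ = 1 ∧ inner ℝ w p = 0 ∧ gaussVector p₀ p w = e ∧
      ∀ z, inner ℝ p z = 0 → inner ℝ w z =
        inner ℝ z e + inner ℝ p e / (1 - inner ℝ p p₀) * inner ℝ z p₀ := by
  have h : (1 : ℝ) - inner ℝ p p₀ ≠ 0 := sub_ne_zero.2 hp.symm
  let a : ℝ := inner ℝ p e / (1 - inner ℝ p p₀)
  have ha : a * (1 - inner ℝ p p₀) = inner ℝ p e := div_mul_cancel₀ _ h
  have hpe : inner ℝ e p = a * (1 - inner ℝ p p₀) := by rw [ha, real_inner_comm]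
  have h0p : inner ℝ p₀ p = inner ℝ p p₀ := real_inner_comm _ _
  have hwp₀ : inner ℝ (e + a • (p₀ - p)) p₀ = a * (1 - inner ℝ p p₀) := by
    rw [inner_add_left, inner_smul_left, inner_sub_left, real_inner_self_eq_norm_sq, h₀, hep]
    simp
  refine ⟨e + a • (p₀ - p), ?_, ?_, ?_, fun z hz => ?_⟩
  · have h2 : ‖e + a • (p₀ - p)‖ ^ 2 = 1 := by
      rw [norm_add_sq_real, norm_smul, mul_pow, norm_sub_sq_real, inner_smul_right,
        inner_sub_right, hep, hpe, h0p, h₀, hp1, he, Real.norm_eq_abs, sq_abs]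
      ring
    exact (pow_eq_one_iff_of_nonneg (norm_nonneg _) two_ne_zero).1 h2
  · rw [inner_add_left, inner_smul_left, inner_sub_left, real_inner_self_eq_norm_sq, hp1, hpe,
      h0p]
    simp only [conj_trivial]
    ring
  · rw [gaussVector, hwp₀, mul_div_cancel_right₀ _ h]
    rw [add_assoc, ← smul_add, sub_add_sub_cancel', sub_self, smul_zero, add_zero]
  · rw [inner_add_left, inner_smul_left, inner_sub_left, hz, real_inner_comm z e,
      real_inner_comm z p₀]
    simp [a]

/-- The coefficient of `gaussVector` is at most `cot a` at points whose distance from `p₀` is at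
least `2 * a`. -/
theorem abs_inner_div_le_cot {a : ℝ} (h₀ : ‖p₀‖ = 1) (hp1 : ‖p‖ = 1) (hζ : ‖ζ‖ = 1)
    (hζp : inner ℝ ζ p = 0) (ha : 0 < Real.sin a) (ha' : 0 ≤ Real.cos a)
    (hp : inner ℝ p p₀ ≤ Real.cos (2 * a)) :
    |inner ℝ ζ p₀ / (1 - inner ℝ p p₀)| ≤ Real.cot a := by
  have hs := Real.sin_sq_add_cos_sq a
  rw [Real.cos_two_mul] at hp
  have hpos : 0 < 1 - inner ℝ p p₀ := by nlinarith
  have hb : (inner ℝ ζ p₀ : ℝ) ^ 2 + inner ℝ p p₀ ^ 2 ≤ 1 := by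
    have h2 : ‖p₀ - (inner ℝ ζ p₀ : ℝ) • ζ - (inner ℝ p p₀ : ℝ) • p‖ ^ 2 =
        1 - (inner ℝ ζ p₀ : ℝ) ^ 2 - inner ℝ p p₀ ^ 2 := by
      rw [norm_sub_sq_real, norm_sub_sq_real, inner_sub_left, norm_smul, norm_smul, mul_pow,
        mul_pow, inner_smul_right, inner_smul_right, inner_smul_left, inner_smul_right, hζp, h₀,
        hp1, hζ, real_inner_comm ζ p₀, real_inner_comm p p₀, Real.norm_eq_abs, sq_abs,
        Real.norm_eq_abs, sq_abs]
      simp only [conj_trivial]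
      ring
    nlinarith [sq_nonneg ‖p₀ - (inner ℝ ζ p₀ : ℝ) • ζ - (inner ℝ p p₀ : ℝ) • p‖]
  rw [abs_div, abs_of_pos hpos, div_le_iff₀ hpos, Real.cot_eq_cos_div_sin]
  refine abs_le_of_sq_le_sq ?_ (by positivity)
  rw [mul_pow, div_pow, div_mul_eq_mul_div, le_div_iff₀ (by positivity)]
  have h1 : (inner ℝ ζ p₀ : ℝ) ^ 2 ≤ (1 - inner ℝ p p₀) * (1 + inner ℝ p p₀) := by nlinarith
  have h3 : (1 + inner ℝ p p₀) * Real.sin a ^ 2 ≤ Real.cos a ^ 2 * (1 - inner ℝ p p₀) := by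
    nlinarith [sq_nonneg (Real.sin a), sq_nonneg (Real.cos a)]
  nlinarith [sq_nonneg (Real.sin a)]

end GaussVector

section Coordinates

/-- Euclidean coordinates on the orthogonal complement of a unit vector. -/
theorem exists_coordinates {n : ℕ} (p₀ : USphere (n + 1)) :
    ∃ (K : EuclideanSpace ℝ (Fin (n + 2)) →L[ℝ] EuclideanSpace ℝ (Fin (n + 1)))
      (K' : EuclideanSpace ℝ (Fin (n + 1)) →L[ℝ] EuclideanSpace ℝ (Fin (n + 2))),
      (∀ z, inner ℝ z (p₀ : EuclideanSpace ℝ (Fin (n + 2))) = 0 → ‖K z‖ = ‖z‖ ∧ K' (K z) = z) ∧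
      ∀ e, inner ℝ (K' e) (p₀ : EuclideanSpace ℝ (Fin (n + 2))) = 0 ∧ ‖K' e‖ = ‖e‖ ∧
        K (K' e) = e := by
  have : Fact (Module.finrank ℝ (EuclideanSpace ℝ (Fin (n + 2))) = n + 1 + 1) := ⟨by simp⟩
  let S := (ℝ ∙ (p₀ : EuclideanSpace ℝ (Fin (n + 2))))ᗮ
  let J : S ≃ₗᵢ[ℝ] EuclideanSpace ℝ (Fin (n + 1)) :=
    (OrthonormalBasis.fromOrthogonalSpanSingleton (𝕜 := ℝ)
    (n + 1) (ne_zero_of_mem_unit_sphere p₀)).repr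
  have hS : ∀ z, inner ℝ z (p₀ : EuclideanSpace ℝ (Fin (n + 2))) = 0 ↔ z ∈ S := fun z =>
    Submodule.mem_orthogonal_singleton_iff_inner_left.symm
  refine ⟨(J : S →L[ℝ] _) ∘L S.orthogonalProjectionOnto,
    S.subtypeL ∘L (J.symm : _ →L[ℝ] S), fun z hz => ?_, fun e => ?_⟩
  · have hz' := (hS z).1 hz
    have hP : S.orthogonalProjectionOnto z = ⟨z, hz'⟩ :=
      Submodule.orthogonalProjectionOnto_mem_subspace_eq_self ⟨z, hz'⟩
    constructor
    · simp [hP]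
    · simp [hP]
  · refine ⟨(hS _).2 (by simp), ?_, ?_⟩
    · exact J.symm.norm_map e
    · simp

end Coordinates

section GaussMap

theorem DifferentiableAt.div_real {V : Type*} [NormedAddCommGroup V] [NormedSpace ℝ V]
    {f g : V → ℝ} {a : V} (hf : DifferentiableAt ℝ f a) (hg : DifferentiableAt ℝ g a)
    (h : g a ≠ 0) : DifferentiableAt ℝ (fun u => f u / g u) a := by
  simp only [div_eq_mul_inv]
  exact hf.mul (hg.inv h)

variable {n : ℕ} {M : Type*} [TopologicalSpace M] [ChartedSpace (EuclideanSpace ℝ (Fin n)) M]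
  {Γ : Type*} [Group Γ] [MulAction Γ (USphere (n + 1))]
  {ι : M → SpaceForm Γ (n + 1)} {U : Set M} {f : M → USphere (n + 1)}
  {η : M → EuclideanSpace ℝ (Fin (n + 2))}

theorem IsOrientedLift.mdifferentiableAt (h : IsOrientedLift ι U f η) {y : M} (hy : y ∈ U) :
    MDifferentiableAt (𝓡 n) 𝓘(ℝ, EuclideanSpace ℝ (Fin (n + 2)))
      (fun z => (f z : EuclideanSpace ℝ (Fin (n + 2)))) y :=
  (h.contMDiffOn.coe_sphere.contMDiffAt (h.isOpen.mem_nhds hy)).mdifferentiableAt (by simp)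

theorem IsOrientedLift.mdifferentiableAt_normal (h : IsOrientedLift ι U f η) {y : M}
    (hy : y ∈ U) : MDifferentiableAt (𝓡 n) 𝓘(ℝ, EuclideanSpace ℝ (Fin (n + 2))) η y :=
  (h.contMDiffOn_normal.contMDiffAt (h.isOpen.mem_nhds hy)).mdifferentiableAt (by simp)

/-- The derivative of the unit normal field is orthogonal to the position vector. -/
theorem IsOrientedLift.inner_ambientDeriv_normal (h : IsOrientedLift ι U f η) {x : M}
    (hx : x ∈ U) (v : EuclideanSpace ℝ (Fin n)) :
    inner ℝ (ambientDeriv n η x v) (f x : EuclideanSpace ℝ (Fin (n + 2))) = 0 := by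
  have hF := hasFDerivAt_ambientDeriv (h.mdifferentiableAt hx)
  have hN := hasFDerivAt_ambientDeriv (h.mdifferentiableAt_normal hx)
  have h1 := hN.inner ℝ hF
  have h2 : (fun t => inner ℝ ((η ∘ (extChartAt (𝓡 n) x).symm) t)
      (((fun z => (f z : EuclideanSpace ℝ (Fin (n + 2)))) ∘ (extChartAt (𝓡 n) x).symm) t))
      =ᶠ[𝓝 (extChartAt (𝓡 n) x x)] fun _ => (0 : ℝ) := by
    have hc : ContinuousAt (extChartAt (𝓡 n) x).symm (extChartAt (𝓡 n) x x) :=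
      continuousAt_extChartAt_symm x
    have hU := hc.preimage_mem_nhds (t := U) (by
      rw [extChartAt_to_inv]
      exact h.isOpen.mem_nhds hx)
    filter_upwards [hU] with t ht using (h.normal _ ht).2.1
  have h3 := congrArg (fun T => T v)
    ((h1.congr_of_eventuallyEq h2.symm).unique (hasFDerivAt_const 0 _))
  simp only [ContinuousLinearMap.comp_apply, fderivInnerCLM_apply,
    ContinuousLinearMap.prod_apply, Function.comp_apply, zero_apply,
    extChartAt_to_inv] at h3
  have h4 := (isUnitNormalAt_iff.1 (h.normal x hx)).2.2 v
  rw [h4, zero_add] at h3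
  exact h3

/-- If the Gauss map has a critical vector `v`, then `v` is a principal direction, whose
principal curvature is the coefficient in the definition of `gaussVector`. -/
theorem IsOrientedLift.isPrincipalCurvature (h : IsOrientedLift ι U f η) {x : M} (hx : x ∈ U)
    {p₀ : EuclideanSpace ℝ (Fin (n + 2))}
    (hp : inner ℝ (f x : EuclideanSpace ℝ (Fin (n + 2))) p₀ ≠ (1 : ℝ))
    {v : EuclideanSpace ℝ (Fin n)} (hv : v ≠ 0)
    (hgv : fderiv ℝ ((fun y => gaussVector p₀ (f y) (η y)) ∘ (extChartAt (𝓡 n) x).symm)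
      (extChartAt (𝓡 n) x x) v = 0) :
    IsPrincipalCurvature ι x
      (inner ℝ (η x) p₀ / (1 - inner ℝ (f x : EuclideanSpace ℝ (Fin (n + 2))) p₀)) := by
  let a := extChartAt (𝓡 n) x x
  let F := (fun z => (f z : EuclideanSpace ℝ (Fin (n + 2)))) ∘ (extChartAt (𝓡 n) x).symm
  let N := η ∘ (extChartAt (𝓡 n) x).symm
  have hF : HasFDerivAt F _ a := hasFDerivAt_ambientDeriv (h.mdifferentiableAt hx)
  have hN : HasFDerivAt N _ a := hasFDerivAt_ambientDeriv (h.mdifferentiableAt_normal hx)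
  have hFa : F a = f x := by simp [F, a]
  have hNa : N a = η x := by simp [N, a]
  let C : EuclideanSpace ℝ (Fin n) → ℝ := fun u => inner ℝ (N u) p₀ / (1 - inner ℝ (F u) p₀)
  have hC : DifferentiableAt ℝ C a := by
    refine (hN.differentiableAt.inner ℝ (differentiableAt_const p₀)).div_real
      ((hF.differentiableAt.inner ℝ (differentiableAt_const p₀)).const_sub 1) ?_
    rw [hFa]
    exact sub_ne_zero.2 hp.symm
  have hG : HasFDerivAt ((fun y => gaussVector p₀ (f y) (η y)) ∘ (extChartAt (𝓡 n) x).symm) _ a :=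
    hN.add (hC.hasFDerivAt.smul (hF.sub_const p₀))
  rw [hG.fderiv] at hgv
  have hgv : ambientDeriv n η x v + (C a • ambientDeriv n
      (fun z => (f z : EuclideanSpace ℝ (Fin (n + 2)))) x v +
      (fderiv ℝ C a v) • (F a - p₀)) = 0 := hgv
  rw [hFa] at hgv
  have h1 := inner_ambientDeriv_coe (h.mdifferentiableAt hx) v
  have h2 := h.inner_ambientDeriv_normal hx v
  have hff : inner ℝ (f x : EuclideanSpace ℝ (Fin (n + 2))) (f x) = (1 : ℝ) := by
    simp
  have h3 : fderiv ℝ C a v = 0 := by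
    have h4 := congrArg (fun z => inner ℝ z (f x : EuclideanSpace ℝ (Fin (n + 2)))) hgv
    simp only [inner_add_left, inner_smul_left, h2, inner_sub_left, hff, inner_zero_left] at h4
    rw [real_inner_comm, h1, real_inner_comm _ p₀] at h4
    have h5 : fderiv ℝ C a v *
        (1 - inner ℝ (f x : EuclideanSpace ℝ (Fin (n + 2))) p₀) = 0 := by
      simpa using h4
    exact (mul_eq_zero.1 h5).resolve_right (sub_ne_zero.2 hp.symm)
  rw [h3, zero_smul, add_zero] at hgv
  refine ⟨U, f, η, h.isOpen, hx, h.proj_eq, h.contMDiffOn, h.contMDiffOn_normal, h.normal, v, hv,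
    ?_⟩
  have h6 : sphereCovDeriv f η x v = ambientDeriv n η x v -
      inner ℝ (ambientDeriv n η x v) (f x : EuclideanSpace ℝ (Fin (n + 2))) •
        (f x : EuclideanSpace ℝ (Fin (n + 2))) := rfl
  rw [h6, h2, zero_smul, sub_zero, eq_neg_of_add_eq_zero_left hgv, neg_neg]
  simp only [C, hFa, hNa]
  rfl

/-- If no principal curvature at `x` has the exceptional value, the Gauss map of an oriented lift,
read in the sphere `S^n`, is a local diffeomorphism at `x`. -/
theorem IsOrientedLift.isLocalDiffeomorphAt [IsManifold (𝓡 n) ∞ M] (h : IsOrientedLift ι U f η)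
    {x : M} (hx : x ∈ U) {p₀ : EuclideanSpace ℝ (Fin (n + 2))}
    (hp : ∀ y ∈ U, inner ℝ (f y : EuclideanSpace ℝ (Fin (n + 2))) p₀ ≠ (1 : ℝ))
    (hcurv : ¬ IsPrincipalCurvature ι x
      (inner ℝ (η x) p₀ / (1 - inner ℝ (f x : EuclideanSpace ℝ (Fin (n + 2))) p₀)))
    {K : EuclideanSpace ℝ (Fin (n + 2)) →L[ℝ] EuclideanSpace ℝ (Fin (n + 1))}
    {K' : EuclideanSpace ℝ (Fin (n + 1)) →L[ℝ] EuclideanSpace ℝ (Fin (n + 2))}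
    {γ : M → USphere n}
    (hγ : ∀ y ∈ U, (γ y : EuclideanSpace ℝ (Fin (n + 1))) = K (gaussVector p₀ (f y) (η y)))
    (hKK' : ∀ y ∈ U, K' (K (gaussVector p₀ (f y) (η y))) = gaussVector p₀ (f y) (η y)) :
    IsLocalDiffeomorphAt (𝓡 n) (𝓡 n) ∞ γ x := by
  have hfact : Fact (Module.finrank ℝ (EuclideanSpace ℝ (Fin (n + 1))) = n + 1) := ⟨by simp⟩
  have hf := h.contMDiffOn.coe_sphere
  have hη := h.contMDiffOn_normal
  have hin : ContMDiffOn (𝓡 n) 𝓘(ℝ, EuclideanSpace ℝ (Fin (n + 2)) × EuclideanSpace ℝ (Fin (n + 2)))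
      ∞ (fun y => ((f y : EuclideanSpace ℝ (Fin (n + 2))), η y)) U := hf.prodMk_space hη
  have hgs : ContDiffOn ℝ ∞ (fun w : EuclideanSpace ℝ (Fin (n + 2)) × EuclideanSpace ℝ (Fin (n + 2))
      => gaussVector p₀ w.1 w.2) {w | inner ℝ w.1 p₀ ≠ (1 : ℝ)} := by
    have h1 : ContDiffOn ℝ ∞ (fun w : EuclideanSpace ℝ (Fin (n + 2)) ×
        EuclideanSpace ℝ (Fin (n + 2)) => inner ℝ w.2 p₀ / (1 - inner ℝ w.1 p₀))
        {w | inner ℝ w.1 p₀ ≠ (1 : ℝ)} :=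
      (contDiffOn_snd.inner ℝ contDiffOn_const).div
        (contDiffOn_const.sub (contDiffOn_fst.inner ℝ contDiffOn_const))
        fun w hw => sub_ne_zero.2 (Ne.symm hw)
    exact contDiffOn_snd.add (h1.smul (contDiffOn_fst.sub contDiffOn_const))
  have hg : ContMDiffOn (𝓡 n) 𝓘(ℝ, EuclideanSpace ℝ (Fin (n + 2))) ∞
      (fun y => gaussVector p₀ (f y) (η y)) U := hgs.contMDiffOn.comp hin fun y hy => hp y hy
  have hγs : ContMDiffOn (𝓡 n) (𝓡 n) ∞ γ U := by
    refine contMDiffOn_of_coe_sphere ?_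
    exact (K.contDiff.contMDiff.comp_contMDiffOn hg).congr fun y hy => hγ y hy
  refine isLocalDiffeomorphAt_of_injective_mfderiv h.isOpen hγs hx ?_
  refine (injective_iff_map_eq_zero (mfderiv (𝓡 n) (𝓡 n) γ x)).2 fun v hv => ?_
  by_contra hv0
  refine hcurv (h.isPrincipalCurvature hx (hp x hx) hv0 ?_)
  have hmd : MDifferentiableAt (𝓡 n) 𝓘(ℝ, EuclideanSpace ℝ (Fin (n + 2)))
      (fun y => gaussVector p₀ (f y) (η y)) x :=
    (hg.contMDiffAt (h.isOpen.mem_nhds hx)).mdifferentiableAt (by simp)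
  rw [(hasFDerivAt_ambientDeriv hmd).fderiv]
  have heq : (fun y => gaussVector p₀ (f y) (η y)) =ᶠ[𝓝 x]
      (fun u : USphere n => K' (u : EuclideanSpace ℝ (Fin (n + 1)))) ∘ γ := by
    filter_upwards [h.isOpen.mem_nhds hx] with y hy
    rw [Function.comp_apply, hγ y hy, hKK' y hy]
  have hγd : MDifferentiableAt (𝓡 n) (𝓡 n) γ x :=
    (hγs.contMDiffAt (h.isOpen.mem_nhds hx)).mdifferentiableAt (by simp)
  have hK'd : MDifferentiableAt (𝓡 n) 𝓘(ℝ, EuclideanSpace ℝ (Fin (n + 2)))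
      (fun u : USphere n => K' (u : EuclideanSpace ℝ (Fin (n + 1)))) (γ x) :=
    ((K'.contDiff (n := ∞)).contMDiff.comp contMDiff_coe_sphere).mdifferentiable (by simp) _
  have hcomp := mfderiv_comp x hK'd hγd
  rw [ambientDeriv, heq.mfderiv_eq, hcomp]
  have h0 : (mfderiv (𝓡 n) 𝓘(ℝ, EuclideanSpace ℝ (Fin (n + 2)))
      (fun u : USphere n => K' (u : EuclideanSpace ℝ (Fin (n + 1)))) (γ x))
      (mfderiv (𝓡 n) (𝓡 n) γ x v) = 0 := by
    rw [hv]
    exact map_zero _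
  exact h0

/-- At a critical point of the height function `⟪f, e⟫ / (1 - ⟪f, p₀⟫)`, which is the height in
the direction `e` after stereographic projection, the Gauss map takes one of the values `±e`. -/
theorem IsOrientedLift.gaussVector_eq_of_isLocalExtr (h : IsOrientedLift ι U f η) {x : M}
    (hx : x ∈ U) {p₀ e : EuclideanSpace ℝ (Fin (n + 2))} (h₀ : ‖p₀‖ = 1)
    (hp : inner ℝ (f x : EuclideanSpace ℝ (Fin (n + 2))) p₀ ≠ (1 : ℝ)) (he : ‖e‖ = 1)
    (hep : inner ℝ e p₀ = 0)
    (hext : IsLocalExtr (fun y => inner ℝ (f y : EuclideanSpace ℝ (Fin (n + 2))) e /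
      (1 - inner ℝ (f y : EuclideanSpace ℝ (Fin (n + 2))) p₀)) x) :
    gaussVector p₀ (f x) (η x) = e ∨ gaussVector p₀ (f x) (η x) = -e := by
  let a := extChartAt (𝓡 n) x x
  let F := (fun z => (f z : EuclideanSpace ℝ (Fin (n + 2)))) ∘ (extChartAt (𝓡 n) x).symm
  have hF : HasFDerivAt F _ a := hasFDerivAt_ambientDeriv (h.mdifferentiableAt hx)
  have hFa : F a = f x := by simp [F, a]
  have hs : (1 : ℝ) - inner ℝ (f x : EuclideanSpace ℝ (Fin (n + 2))) p₀ ≠ 0 :=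
    sub_ne_zero.2 hp.symm
  have hext' : IsLocalExtr (fun u => inner ℝ (F u) e / (1 - inner ℝ (F u) p₀)) a := by
    have hc : Filter.Tendsto (extChartAt (𝓡 n) x).symm (𝓝 a) (𝓝 x) := by
      have := continuousAt_extChartAt_symm (I := 𝓡 n) x
      rwa [ContinuousAt, extChartAt_to_inv] at this
    have hax : (extChartAt (𝓡 n) x).symm a = x := extChartAt_to_inv x
    rcases hext with hm | hm
    · left
      have := hc.eventually hm
      simp only [IsMinFilter, F, Function.comp_apply, hax]
      exact this
    · right
      have := hc.eventually hm
      simp only [IsMaxFilter, F, Function.comp_apply, hax]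
      exact this
  have hcrit : ∀ v, inner ℝ (ambientDeriv n (fun z => (f z : EuclideanSpace ℝ (Fin (n + 2)))) x v) e
      + inner ℝ (f x : EuclideanSpace ℝ (Fin (n + 2))) e /
        (1 - inner ℝ (f x : EuclideanSpace ℝ (Fin (n + 2))) p₀) *
      inner ℝ (ambientDeriv n (fun z => (f z : EuclideanSpace ℝ (Fin (n + 2)))) x v) p₀ = 0 := by
    intro v
    have h1 := hF.inner ℝ (hasFDerivAt_const e a)
    have h2 := hF.inner ℝ (hasFDerivAt_const p₀ a)
    let H : EuclideanSpace ℝ (Fin n) → ℝ := fun u => inner ℝ (F u) e / (1 - inner ℝ (F u) p₀)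
    have hs' : (1 : ℝ) - inner ℝ (F a) p₀ ≠ 0 := by rwa [hFa]
    have hH : HasFDerivAt H (0 : EuclideanSpace ℝ (Fin n) →L[ℝ] ℝ) a := by
      have hd : DifferentiableAt ℝ H a :=
        h1.differentiableAt.div_real (h2.differentiableAt.const_sub 1) hs'
      have := hd.hasFDerivAt
      rwa [hext'.hasFDerivAt_eq_zero this] at this
    have h3 : (fun u => H u * (1 - inner ℝ (F u) p₀)) =ᶠ[𝓝 a] fun u => inner ℝ (F u) e := by
      filter_upwards [(h2.const_sub 1).continuousAt.eventually_ne hs'] with u hu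
      exact div_mul_cancel₀ _ hu
    have h4 := congrArg (fun T => T v)
      (((hH.mul (h2.const_sub 1)).congr_of_eventuallyEq h3.symm).unique h1)
    simp [hFa, H] at h4
    linarith
  obtain ⟨w, hw, hwf, hwe, hwd⟩ := exists_gaussVector_eq h₀ (norm_eq_of_mem_sphere (f x)) hp he hep
  have hwn : IsUnitNormalAt f (fun _ => w) x := by
    refine isUnitNormalAt_iff.2 ⟨hw, hwf, fun v => ?_⟩
    rw [hwd _ (inner_ambientDeriv_coe (h.mdifferentiableAt hx) v)]
    exact hcrit v
  rcases h.eq_or_eq_neg x hx w hwn with h1 | h1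
  · left
    rw [← h1, hwe]
  · right
    rw [← neg_eq_iff_eq_neg.2 h1, gaussVector_neg, hwe]

end GaussMap

/-! ### The oriented preimage of the hypersurface -/

section OrientedPreimage

variable {n : ℕ} {M : Type*} [TopologicalSpace M] [ChartedSpace (EuclideanSpace ℝ (Fin n)) M]
  {Γ : Type*} [Group Γ] [MulAction Γ (USphere (n + 1))]
  {ι : M → SpaceForm Γ (n + 1)} {U U' : Set M} {f f' : M → USphere (n + 1)}
  {η η' : M → EuclideanSpace ℝ (Fin (n + 2))}

theorem IsUnitNormalAt.congr {y : M} {ζ : EuclideanSpace ℝ (Fin (n + 2))} (h : f =ᶠ[𝓝 y] f')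
    (hζ : IsUnitNormalAt f (fun _ => ζ) y) : IsUnitNormalAt f' (fun _ => ζ) y := by
  have h1 : (fun z => (f z : EuclideanSpace ℝ (Fin (n + 2)))) =ᶠ[𝓝 y]
      fun z => (f' z : EuclideanSpace ℝ (Fin (n + 2))) := h.fun_comp Subtype.val
  have h2 : ambientDeriv n (fun z => (f z : EuclideanSpace ℝ (Fin (n + 2)))) y =
      ambientDeriv n (fun z => (f' z : EuclideanSpace ℝ (Fin (n + 2)))) y := h1.mfderiv_eq
  rw [isUnitNormalAt_iff] at hζ ⊢
  rwa [← h2, ← h.self_of_nhds]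

/-- The oriented preimage of the hypersurface `ι`: the triples of a point `x`, a point `p` of the
sphere over `ι x`, and a unit normal at `p` of the lifted hypersurface. -/
def orientedPreimage (ι : M → SpaceForm Γ (n + 1)) :
    Set (M × USphere (n + 1) × EuclideanSpace ℝ (Fin (n + 2))) :=
  {z | ∃ (U : Set M) (f : M → USphere (n + 1)) (η : M → EuclideanSpace ℝ (Fin (n + 2))),
    IsOrientedLift ι U f η ∧ z.1 ∈ U ∧ f z.1 = z.2.1 ∧ η z.1 = z.2.2}

theorem IsOrientedLift.mem_orientedPreimage (h : IsOrientedLift ι U f η) {y : M} (hy : y ∈ U) :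
    (y, f y, η y) ∈ orientedPreimage ι :=
  ⟨U, f, η, h, hy, rfl, rfl⟩

theorem proj_of_mem_orientedPreimage {z : M × USphere (n + 1) × EuclideanSpace ℝ (Fin (n + 2))}
    (hz : z ∈ orientedPreimage ι) : ι z.1 = spaceFormProj Γ z.2.1 := by
  obtain ⟨U, f, η, h, hy, hf, -⟩ := hz
  rw [← h.proj_eq _ hy, hf]

theorem isUnitNormal_of_mem_orientedPreimage
    {z : M × USphere (n + 1) × EuclideanSpace ℝ (Fin (n + 2))}
    (hz : z ∈ orientedPreimage ι) : ‖z.2.2‖ = 1 ∧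
      inner ℝ z.2.2 (z.2.1 : EuclideanSpace ℝ (Fin (n + 2))) = 0 := by
  obtain ⟨U, f, η, h, hy, hf, hη⟩ := hz
  rw [← hf, ← hη]
  exact ⟨(h.normal _ hy).1, (h.normal _ hy).2.1⟩

theorem neg_mem_orientedPreimage {z : M × USphere (n + 1) × EuclideanSpace ℝ (Fin (n + 2))}
    (hz : z ∈ orientedPreimage ι) : (z.1, z.2.1, -z.2.2) ∈ orientedPreimage ι := by
  obtain ⟨U, f, η, h, hy, hf, hη⟩ := hz
  exact ⟨U, f, fun y => -η y, h.neg, hy, hf, by rw [← hη]⟩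

variable [IsIsometricSMul Γ (USphere (n + 1))] [ActsProperlyDiscontinuously Γ (USphere (n + 1))]

/-- Near a point of the lift, the only points of the sphere over the hypersurface are those of
the lift. -/
theorem IsOrientedLift.eventually_eq (h : IsOrientedLift ι U f η) {x : M} (hx : x ∈ U) :
    ∀ᶠ q : M × USphere (n + 1) in 𝓝 (x, f x),
      q.1 ∈ U ∧ (ι q.1 = spaceFormProj Γ q.2 → f q.1 = q.2) := by
  have hπ := (isQuotientCoveringMap_spaceFormProj (Γ := Γ)
    (m := n + 1)).isCoveringMap.isLocalHomeomorph
  obtain ⟨e, he, hee⟩ := hπ (f x)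
  have hfc : ContinuousAt f x := h.contMDiffOn.continuousOn.continuousAt (h.isOpen.mem_nhds hx)
  have h1 : ∀ᶠ q : M × USphere (n + 1) in 𝓝 (x, f x), q.1 ∈ U :=
    continuousAt_fst.eventually (h.isOpen.mem_nhds hx)
  have h2 : ∀ᶠ q : M × USphere (n + 1) in 𝓝 (x, f x), q.2 ∈ e.source :=
    continuousAt_snd.eventually (e.open_source.mem_nhds he)
  have h3 : ∀ᶠ q : M × USphere (n + 1) in 𝓝 (x, f x), f q.1 ∈ e.source :=
    (ContinuousAt.comp (g := f) (f := Prod.fst) (x := (x, f x)) hfc continuousAt_fst).eventually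
      (e.open_source.mem_nhds he)
  filter_upwards [h1, h2, h3] with q hq1 hq2 hq3
  refine ⟨hq1, fun hq => e.injOn hq3 hq2 ?_⟩
  rw [← hee, h.proj_eq _ hq1, hq]

theorem IsOrientedLift.eventuallyEq (h : IsOrientedLift ι U f η) (h' : IsOrientedLift ι U' f' η')
    {x : M} (hx : x ∈ U) (hx' : x ∈ U') (hxx : f x = f' x) : f =ᶠ[𝓝 x] f' := by
  have hfc : ContinuousAt f' x :=
    h'.contMDiffOn.continuousOn.continuousAt (h'.isOpen.mem_nhds hx')
  have hc : Filter.Tendsto (fun y => (y, f' y)) (𝓝 x) (𝓝 (x, f x)) := by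
    rw [hxx]
    exact continuousAt_id.prodMk hfc
  filter_upwards [hc.eventually (h.eventually_eq hx), h'.isOpen.mem_nhds hx'] with y hy hy'
  exact hy.2 (h'.proj_eq y hy').symm

theorem IsOrientedLift.eq_or_eq_neg_of_mem (h : IsOrientedLift ι U f η)
    {z : M × USphere (n + 1) × EuclideanSpace ℝ (Fin (n + 2))} (hz : z ∈ orientedPreimage ι)
    (hzU : z.1 ∈ U) (hfz : f z.1 = z.2.1) : z.2.2 = η z.1 ∨ z.2.2 = -η z.1 := by
  obtain ⟨U', f', η', h', hzU', hf', hη'⟩ := hz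
  refine h.eq_or_eq_neg z.1 hzU _ (IsUnitNormalAt.congr
    (h'.eventuallyEq h hzU' hzU (hf'.trans hfz.symm)) ?_)
  rw [← hη']
  exact h'.normal _ hzU'

/-- Near a point of the oriented preimage, an oriented lift through the point parametrizes the
oriented preimage. -/
theorem IsOrientedLift.eventually_eq_of_mem (h : IsOrientedLift ι U f η) {x : M} (hx : x ∈ U) :
    ∀ᶠ z in 𝓝 ((x, f x, η x) : M × USphere (n + 1) × EuclideanSpace ℝ (Fin (n + 2))),
      z.1 ∈ U ∧ (z ∈ orientedPreimage ι → z = (z.1, f z.1, η z.1)) := by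
  have hηc : ContinuousAt η x :=
    h.contMDiffOn_normal.continuousOn.continuousAt (h.isOpen.mem_nhds hx)
  have hc : Filter.Tendsto
      (fun z : M × USphere (n + 1) × EuclideanSpace ℝ (Fin (n + 2)) => (z.1, z.2.1))
      (𝓝 (x, f x, η x)) (𝓝 (x, f x)) := by
    have : Continuous
      (fun z : M × USphere (n + 1) × EuclideanSpace ℝ (Fin (n + 2)) => (z.1, z.2.1)) := by
      fun_prop
    exact this.tendsto _
  have hc2 : ContinuousAt (fun z : M × USphere (n + 1) × EuclideanSpace ℝ (Fin (n + 2)) =>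
      (inner ℝ z.2.2 (η z.1) : ℝ)) (x, f x, η x) := by
    have h1 : ContinuousAt (fun z : M × USphere (n + 1) × EuclideanSpace ℝ (Fin (n + 2)) =>
        η z.1) (x, f x, η x) := ContinuousAt.comp (g := η) hηc continuousAt_fst
    exact (continuousAt_snd.snd).inner h1
  have hpos : (0 : ℝ) < inner ℝ (η x) (η x) := by
    rw [real_inner_self_eq_norm_sq, (h.normal x hx).1]
    norm_num
  filter_upwards [hc.eventually (h.eventually_eq hx), hc2.eventually (lt_mem_nhds hpos)]
    with z hz hz2
  refine ⟨hz.1, fun hzι => ?_⟩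
  have hfz := hz.2 (proj_of_mem_orientedPreimage hzι)
  rcases h.eq_or_eq_neg_of_mem hzι hz.1 hfz with h3 | h3
  · rw [hfz, ← h3]
  · rw [h3, inner_neg_left, real_inner_self_eq_norm_sq, (h.normal _ hz.1).1] at hz2
    norm_num at hz2

/-- The projection of the oriented preimage to the hypersurface is a local homeomorphism, the
local inverses being the oriented lifts. -/
theorem isLocalHomeomorph_fst_orientedPreimage :
    IsLocalHomeomorph (fun z : orientedPreimage ι => z.1.1) := by
  classical
  refine IsLocalHomeomorph.of_local_sections (by fun_prop) fun z => ?_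
  obtain ⟨⟨x, p, ζ⟩, U, f, η, h, hx, hf, hη⟩ := z
  obtain rfl : f x = p := hf
  obtain rfl : η x = ζ := hη
  refine ⟨U, fun y => if hy : y ∈ U then ⟨(y, f y, η y), h.mem_orientedPreimage hy⟩ else
    ⟨(x, f x, η x), h.mem_orientedPreimage hx⟩, h.isOpen, hx, ?_, fun y hy => ?_, ?_⟩
  · rw [Topology.IsInducing.subtypeVal.continuousOn_iff]
    refine ContinuousOn.congr (f := fun y => (y, f y, η y)) ?_ fun y hy => by
      simp [hy]
    exact continuousOn_id.prodMk (h.contMDiffOn.continuousOn.prodMk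
      h.contMDiffOn_normal.continuousOn)
  · simp [hy]
  · have := (continuous_subtype_val.tendsto (⟨(x, f x, η x), h.mem_orientedPreimage hx⟩ :
      orientedPreimage ι)).eventually (h.eventually_eq_of_mem hx)
    filter_upwards [this] with z hz
    refine Subtype.ext ?_
    simp only [hz.1, dite_true]
    exact (hz.2 z.2).symm

variable [IsManifold (𝓡 n) ∞ M]

/-- The oriented preimage is closed: over a local lift it consists of the two unit normals. -/
theorem isClosed_orientedPreimage (hι : Manifold.IsImmersion (𝓡 n) (𝓡 (n + 1)) ∞ ι) :
    IsClosed (orientedPreimage ι) := by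
  have hιc : Continuous ι := continuous_iff_continuousAt.2 fun x =>
    (hι.isImmersionAt x).continuousAt
  have hπc : Continuous (spaceFormProj Γ (m := n + 1)) :=
    isQuotientCoveringMap_spaceFormProj.continuous
  refine isClosed_of_closure_subset fun a ha => ?_
  have haι : ι a.1 = spaceFormProj Γ a.2.1 := by
    have hcl : IsClosed {z : M × USphere (n + 1) × EuclideanSpace ℝ (Fin (n + 2)) |
        ι z.1 = spaceFormProj Γ z.2.1} :=
      isClosed_eq (hιc.comp continuous_fst) (hπc.comp continuous_snd.fst)
    exact closure_minimal (fun z hz => proj_of_mem_orientedPreimage hz) hcl ha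
  obtain ⟨U, f, η, h, haU, hfa⟩ := exists_isOrientedLift (hι.isImmersionAt a.1) haι
  have hηc : ContinuousAt η a.1 :=
    h.contMDiffOn_normal.continuousOn.continuousAt (h.isOpen.mem_nhds haU)
  have h1 : ContinuousAt (fun z : M × USphere (n + 1) × EuclideanSpace ℝ (Fin (n + 2)) =>
      ‖z.2.2 - η z.1‖ * ‖z.2.2 + η z.1‖) a := by
    have h2 : ContinuousAt (fun z : M × USphere (n + 1) × EuclideanSpace ℝ (Fin (n + 2)) =>
        η z.1) a := ContinuousAt.comp (g := η) hηc continuousAt_fst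
    exact (continuousAt_snd.snd.sub h2).norm.mul (continuousAt_snd.snd.add h2).norm
  have hc : Filter.Tendsto
      (fun z : M × USphere (n + 1) × EuclideanSpace ℝ (Fin (n + 2)) => (z.1, z.2.1))
      (𝓝 a) (𝓝 (a.1, f a.1)) := by
    have : Continuous
      (fun z : M × USphere (n + 1) × EuclideanSpace ℝ (Fin (n + 2)) => (z.1, z.2.1)) := by
      fun_prop
    rw [hfa]
    exact this.tendsto a
  have h0 : ‖a.2.2 - η a.1‖ * ‖a.2.2 + η a.1‖ = 0 := by
    have hne : Filter.NeBot (𝓝[(orientedPreimage ι)] a) := mem_closure_iff_nhdsWithin_neBot.1 ha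
    refine tendsto_nhds_unique (l := 𝓝[orientedPreimage ι] a) (h1.mono_left nhdsWithin_le_nhds)
      (tendsto_const_nhds.congr' ?_)
    filter_upwards [nhdsWithin_le_nhds (hc.eventually (h.eventually_eq haU)),
      self_mem_nhdsWithin] with z hz hzι
    have hz' : z ∈ orientedPreimage ι := hzι
    rcases h.eq_or_eq_neg_of_mem hz' hz.1 (hz.2 (proj_of_mem_orientedPreimage hz')) with h3 | h3
    · rw [h3, sub_self, norm_zero, zero_mul]
    · rw [h3, neg_add_cancel, norm_zero, mul_zero]
  rcases mul_eq_zero.1 h0 with h2 | h2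
  · have h3 : a = (a.1, f a.1, η a.1) := by
      rw [hfa, ← sub_eq_zero.1 (norm_eq_zero.1 h2)]
    rw [h3]
    exact h.mem_orientedPreimage haU
  · have h3 : a = (a.1, f a.1, -η a.1) := by
      rw [hfa, ← eq_neg_of_add_eq_zero_left (norm_eq_zero.1 h2)]
    rw [h3]
    exact h.neg.mem_orientedPreimage haU

theorem compactSpace_orientedPreimage [CompactSpace M]
    (hι : Manifold.IsImmersion (𝓡 n) (𝓡 (n + 1)) ∞ ι) : CompactSpace (orientedPreimage ι) := by
  rw [← isCompact_iff_compactSpace]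
  refine (isCompact_univ.prod (isCompact_univ.prod (isCompact_closedBall
    (0 : EuclideanSpace ℝ (Fin (n + 2))) 1))).of_isClosed_subset
    (isClosed_orientedPreimage hι) fun z hz => ⟨trivial, trivial, ?_⟩
  rw [mem_closedBall_zero_iff, (isUnitNormal_of_mem_orientedPreimage hz).1]

end OrientedPreimage

/-! ### The components of the oriented preimage are spheres -/

section Components

variable {n : ℕ} {M : Type*} [TopologicalSpace M] [ChartedSpace (EuclideanSpace ℝ (Fin n)) M]
  {Γ : Type*} [Group Γ] [MulAction Γ (USphere (n + 1))]
  {ι : M → SpaceForm Γ (n + 1)}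

/-- The Gauss map `G` of the oriented preimage, with values in the unit sphere of the orthogonal
complement of `p₀`; the latter is parametrized by a linear isometric embedding `K`. Smoothness is
not expressed on the oriented preimage, which carries no charts: near every point, `G` is a local
diffeomorphism `γ` of the hypersurface composed with the projection. -/
structure IsGaussMap (p₀ : USphere (n + 1))
    (K : EuclideanSpace ℝ (Fin (n + 1)) →L[ℝ] EuclideanSpace ℝ (Fin (n + 2)))
    (G : orientedPreimage ι → USphere n) : Prop where
  norm_map : ∀ e, ‖K e‖ = ‖e‖
  inner_map : ∀ e, inner ℝ (K e) (p₀ : EuclideanSpace ℝ (Fin (n + 2))) = 0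
  map_eq : ∀ z, K (G z) = gaussVector (p₀ : EuclideanSpace ℝ (Fin (n + 2))) z.1.2.1 z.1.2.2
  isLocalDiffeomorphAt : ∀ z, ∃ γ : M → USphere n,
    IsLocalDiffeomorphAt (𝓡 n) (𝓡 n) ∞ γ z.1.1 ∧ ∀ᶠ z' in 𝓝 z, G z' = γ z'.1.1

/-- The Gauss map exists if `p₀` does not lie over the hypersurface and the coefficient in the
definition of `gaussVector` is never a principal curvature. -/
theorem exists_isGaussMap [IsIsometricSMul Γ (USphere (n + 1))]
    [ActsProperlyDiscontinuously Γ (USphere (n + 1))] [IsManifold (𝓡 n) ∞ M] (p₀ : USphere (n + 1))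
    (hp : ∀ x p, ι x = spaceFormProj Γ p →
      inner ℝ (p : EuclideanSpace ℝ (Fin (n + 2))) (p₀ : EuclideanSpace ℝ (Fin (n + 2))) ≠ (1 : ℝ))
    (hcurv : ∀ z ∈ orientedPreimage ι, ¬ IsPrincipalCurvature ι z.1
      (inner ℝ z.2.2 (p₀ : EuclideanSpace ℝ (Fin (n + 2))) /
        (1 - inner ℝ (z.2.1 : EuclideanSpace ℝ (Fin (n + 2)))
          (p₀ : EuclideanSpace ℝ (Fin (n + 2)))))) :
    ∃ K, ∃ G : orientedPreimage ι → USphere n, IsGaussMap p₀ K G := by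
  classical
  obtain ⟨L, K, hL, hK⟩ := exists_coordinates p₀
  have h₀ : ‖(p₀ : EuclideanSpace ℝ (Fin (n + 2)))‖ = 1 := norm_eq_of_mem_sphere p₀
  have hperp : ∀ z : orientedPreimage ι,
      inner ℝ (gaussVector (p₀ : EuclideanSpace ℝ (Fin (n + 2))) z.1.2.1 z.1.2.2)
        (p₀ : EuclideanSpace ℝ (Fin (n + 2))) = 0 := fun z =>
    inner_gaussVector h₀ (hp _ _ (proj_of_mem_orientedPreimage z.2))
  let G : orientedPreimage ι → USphere n := fun z =>
    ⟨L (gaussVector (p₀ : EuclideanSpace ℝ (Fin (n + 2))) z.1.2.1 z.1.2.2), by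
      rw [mem_sphere_zero_iff_norm, (hL _ (hperp z)).1]
      exact norm_gaussVector h₀ (norm_eq_of_mem_sphere _)
        (hp _ _ (proj_of_mem_orientedPreimage z.2))
        (isUnitNormal_of_mem_orientedPreimage z.2).1 (isUnitNormal_of_mem_orientedPreimage z.2).2⟩
  refine ⟨K, G, fun e => (hK e).2.1, fun e => (hK e).1, fun z => (hL _ (hperp z)).2, fun z => ?_⟩
  obtain ⟨⟨x, p, ζ⟩, U, f, η, h, hx, hf, hη⟩ := z
  obtain rfl : f x = p := hf
  obtain rfl : η x = ζ := hη
  let s : M → orientedPreimage ι := fun y => if hy : y ∈ U then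
    ⟨(y, f y, η y), h.mem_orientedPreimage hy⟩ else ⟨(x, f x, η x), h.mem_orientedPreimage hx⟩
  have hs : ∀ y ∈ U, (s y).1 = (y, f y, η y) := fun y hy => by simp [s, hy]
  refine ⟨fun y => G (s y), h.isLocalDiffeomorphAt hx (fun y hy => hp y _ (h.proj_eq y hy).symm)
    (hcurv _ (h.mem_orientedPreimage hx)) (K := L) (K' := K) (fun y hy => ?_) fun y hy => ?_, ?_⟩
  · change L _ = _
    rw [hs y hy]
  · exact (hL _ (hperp ⟨_, h.mem_orientedPreimage hy⟩)).2
  · have := (continuous_subtype_val.tendsto (⟨(x, f x, η x), h.mem_orientedPreimage hx⟩ :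
      orientedPreimage ι)).eventually (h.eventually_eq_of_mem hx)
    filter_upwards [this] with z hz
    congr 1
    exact Subtype.ext ((hz.2 z.2).trans (hs _ hz.1).symm)

variable {p₀ : USphere (n + 1)}
  {K : EuclideanSpace ℝ (Fin (n + 1)) →L[ℝ] EuclideanSpace ℝ (Fin (n + 2))}
  {G : orientedPreimage ι → USphere n}

theorem IsGaussMap.eq_of_map_eq (hG : IsGaussMap p₀ K G) {u v : USphere n}
    (h : K (u : EuclideanSpace ℝ (Fin (n + 1))) = K v) : u = v := by
  have h1 := hG.norm_map (u - v)
  rw [map_sub, h, sub_self, norm_zero] at h1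
  exact Subtype.ext (sub_eq_zero.1 (norm_eq_zero.1 h1.symm))

/-- Reversal of the unit normal. -/
def flipNormal (z : orientedPreimage ι) : orientedPreimage ι :=
  ⟨(z.1.1, z.1.2.1, -z.1.2.2), neg_mem_orientedPreimage z.2⟩

theorem continuous_flipNormal : Continuous (flipNormal (ι := ι)) :=
  Continuous.subtype_mk (by fun_prop) _

theorem IsGaussMap.map_flipNormal (hG : IsGaussMap p₀ K G) (z : orientedPreimage ι) :
    G (flipNormal z) = -G z := by
  refine hG.eq_of_map_eq ?_
  rw [hG.map_eq]
  change gaussVector _ _ (-_) = K (-(G z : EuclideanSpace ℝ (Fin (n + 1))))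
  rw [gaussVector_neg, map_neg, hG.map_eq]
  rfl

/-- The height, in the direction `e`, of the stereographic projection of `p` from `p₀`. -/
def stereoHeight (p₀ e : EuclideanSpace ℝ (Fin (n + 2))) (p : USphere (n + 1)) : ℝ :=
  inner ℝ (p : EuclideanSpace ℝ (Fin (n + 2))) e /
    (1 - inner ℝ (p : EuclideanSpace ℝ (Fin (n + 2))) p₀)

/-- Where the height in the direction `e` is extremal, the Gauss map has the value `e` or `-e`. -/
theorem IsGaussMap.eq_or_eq_neg (hG : IsGaussMap p₀ K G)
    (hp : ∀ x p, ι x = spaceFormProj Γ p →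
      inner ℝ (p : EuclideanSpace ℝ (Fin (n + 2))) (p₀ : EuclideanSpace ℝ (Fin (n + 2))) ≠ (1 : ℝ))
    (e : USphere n) {N : Set (orientedPreimage ι)} (hN : IsOpen N) {z : orientedPreimage ι}
    (hz : z ∈ N) (hext : IsExtrOn (fun z' : orientedPreimage ι =>
      stereoHeight (p₀ : EuclideanSpace ℝ (Fin (n + 2))) (K e) z'.1.2.1) N z) :
    G z = e ∨ G z = -e := by
  classical
  have hmap := hG.map_eq z
  obtain ⟨⟨x, p, ζ⟩, U, f, η, h, hx, hf, hη⟩ := z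
  obtain rfl : f x = p := hf
  obtain rfl : η x = ζ := hη
  let s : M → orientedPreimage ι := fun y => if hy : y ∈ U then
    ⟨(y, f y, η y), h.mem_orientedPreimage hy⟩ else ⟨(x, f x, η x), h.mem_orientedPreimage hx⟩
  have hs : ∀ y ∈ U, (s y).1 = (y, f y, η y) := fun y hy => by simp [s, hy]
  have hsx : s x = ⟨(x, f x, η x), h.mem_orientedPreimage hx⟩ := Subtype.ext (hs x hx)
  have hsc : ContinuousAt s x := by
    rw [Topology.IsInducing.subtypeVal.continuousAt_iff]
    have h1 : ContinuousOn (fun y => (y, f y, η y)) U :=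
      continuousOn_id.prodMk (h.contMDiffOn.continuousOn.prodMk h.contMDiffOn_normal.continuousOn)
    exact (h1.congr hs).continuousAt (h.isOpen.mem_nhds hx)
  have hev : ∀ᶠ y in 𝓝 x, y ∈ U ∧ s y ∈ N := by
    filter_upwards [h.isOpen.mem_nhds hx,
      hsc.eventually (hN.mem_nhds (by rw [hsx]; exact hz))] with y hy hy' using ⟨hy, hy'⟩
  have hloc : IsLocalExtr (fun y => stereoHeight (p₀ : EuclideanSpace ℝ (Fin (n + 2))) (K e) (f y))
      x := by
    rcases hext with hm | hm
    · left
      filter_upwards [hev] with y hy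
      have h1 : stereoHeight _ (K e) (f x) ≤ stereoHeight p₀ (K e) (s y).1.2.1 := hm hy.2
      rwa [hs y hy.1] at h1
    · right
      filter_upwards [hev] with y hy
      have h1 : stereoHeight p₀ (K e) (s y).1.2.1 ≤ stereoHeight _ (K e) (f x) := hm hy.2
      rwa [hs y hy.1] at h1
  have he : ‖K e‖ = 1 := by rw [hG.norm_map, norm_eq_of_mem_sphere]
  rcases h.gaussVector_eq_of_isLocalExtr hx (norm_eq_of_mem_sphere p₀)
    (hp x _ (h.proj_eq x hx).symm) he (hG.inner_map e) hloc with h2 | h2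
  · left
    exact hG.eq_of_map_eq (hmap.trans h2)
  · right
    refine hG.eq_of_map_eq (hmap.trans (h2.trans ?_))
    exact (map_neg K _).symm

variable [IsIsometricSMul Γ (USphere (n + 1))] [ActsProperlyDiscontinuously Γ (USphere (n + 1))]

theorem IsGaussMap.isLocalHomeomorph (hG : IsGaussMap p₀ K G) : IsLocalHomeomorph G := by
  refine IsLocalHomeomorph.mk _ fun z => ?_
  obtain ⟨γ, ⟨Φ, hzΦ, hΦ⟩, hγ⟩ := hG.isLocalDiffeomorphAt z
  obtain ⟨e, he, hee⟩ := isLocalHomeomorph_fst_orientedPreimage (ι := ι) z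
  obtain ⟨W, hW, hWo, hzW⟩ := eventually_nhds_iff.1 hγ
  have hee' : ∀ z', e z' = z'.1.1 := fun z' => (congrFun hee z').symm
  refine ⟨(e.restrOpen W hWo).trans Φ.toOpenPartialHomeomorph, ?_, fun z' hz' => ?_⟩
  · rw [OpenPartialHomeomorph.trans_source]
    exact ⟨⟨he, hzW⟩, by
      change e z ∈ Φ.source
      rwa [hee']⟩
  · rw [OpenPartialHomeomorph.trans_source] at hz'
    have h1 : e z' ∈ Φ.source := hz'.2
    have h2 : G z' = γ (e z') := by
      rw [hee']
      exact hW z' hz'.1.2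
    rw [h2, hΦ h1]
    rfl

theorem locallyConnectedSpace_orientedPreimage : LocallyConnectedSpace (orientedPreimage ι) := by
  have : LocallyConnectedSpace M :=
    ChartedSpace.locallyConnectedSpace (EuclideanSpace ℝ (Fin n)) M
  exact (isLocalHomeomorph_fst_orientedPreimage (ι := ι)).locallyConnectedSpace

/-- For `n ≥ 2`, the Gauss map has a continuous inverse on every component of the oriented
preimage. -/
theorem IsGaussMap.exists_section (hn : 2 ≤ n) [T2Space M] [CompactSpace (orientedPreimage ι)]
    (hG : IsGaussMap p₀ K G) (z₀ : orientedPreimage ι) :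
    ∃ ψ : USphere n → orientedPreimage ι, Continuous ψ ∧ (∀ u, G (ψ u) = u) ∧
      Set.range ψ = connectedComponent z₀ := by
  have := locallyConnectedSpace_orientedPreimage (ι := ι)
  have hopen : IsOpen (connectedComponent z₀) := isOpen_connectedComponent
  have : CompactSpace (connectedComponent z₀) :=
    isCompact_iff_compactSpace.1 isClosed_connectedComponent.isCompact
  have : ConnectedSpace (connectedComponent z₀) :=
    isConnected_iff_connectedSpace.1 isConnected_connectedComponent
  have hloc : IsLocalHomeomorph (G ∘ ((↑) : connectedComponent z₀ → orientedPreimage ι)) :=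
    hG.isLocalHomeomorph.comp hopen.isOpenEmbedding_subtypeVal.isLocalHomeomorph
  let e := Continuous.homeoOfEquivCompactToT2
    (f := Equiv.ofBijective _ (hloc.bijective_of_sphere hn)) hloc.continuous
  refine ⟨fun u => (e.symm u : orientedPreimage ι), by fun_prop,
    fun u => e.apply_symm_apply u, ?_⟩
  ext z
  constructor
  · rintro ⟨u, rfl⟩
    exact (e.symm u).2
  · intro hz
    exact ⟨e ⟨z, hz⟩, congrArg Subtype.val (e.symm_apply_apply ⟨z, hz⟩)⟩

/-- A component of the oriented preimage contains at most one of the two unit normals at each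
point. Otherwise it is invariant under reversal of the normal; for any direction `e`, the Gauss
map takes the value `e` at a point with maximal height and, after reversal, at a point with
minimal height, so that the height is constant, and every point is extremal. -/
theorem IsGaussMap.eq_of_eq (hn : 1 ≤ n) [CompactSpace (orientedPreimage ι)]
    (hG : IsGaussMap p₀ K G)
    (hp : ∀ x p, ι x = spaceFormProj Γ p →
      inner ℝ (p : EuclideanSpace ℝ (Fin (n + 2))) (p₀ : EuclideanSpace ℝ (Fin (n + 2))) ≠ (1 : ℝ))
    {z₀ : orientedPreimage ι} {ψ : USphere n → orientedPreimage ι}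
    (hGψ : ∀ u, G (ψ u) = u) (hψr : Set.range ψ = connectedComponent z₀) {u v : USphere n}
    (h1 : (ψ u).1.1 = (ψ v).1.1) (h2 : (ψ u).1.2.1 = (ψ v).1.2.1) : u = v := by
  have hflip : ψ v = ψ u ∨ ψ v = flipNormal (ψ u) := by
    obtain ⟨U, f, η, h, hx, hf, hη⟩ := (ψ u).2
    rcases h.eq_or_eq_neg_of_mem (ψ v).2 (h1 ▸ hx) (by rw [← h1, ← h2, hf]) with h3 | h3
    · left
      refine Subtype.ext (Prod.ext h1.symm (Prod.ext h2.symm ?_))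
      rw [h3, ← h1, hη]
    · right
      refine Subtype.ext (Prod.ext h1.symm (Prod.ext h2.symm ?_))
      rw [h3, ← h1, hη]
      rfl
  rcases hflip with h | hflip
  · rw [← hGψ u, ← hGψ v, h]
  exfalso
  have hψN : ∀ w, ψ w ∈ connectedComponent z₀ := fun w => hψr ▸ Set.mem_range_self w
  have hN : ∀ z ∈ connectedComponent z₀, flipNormal z ∈ connectedComponent z₀ := by
    intro z hz
    have e1 := connectedComponent_eq (hψN u)
    have e2 := connectedComponent_eq (hψN v)
    rw [e1] at hz
    have h3 := continuous_flipNormal.image_connectedComponent_subset (ψ u) ⟨z, hz, rfl⟩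
    rwa [← hflip, ← e2] at h3
  have hinj : ∀ z ∈ connectedComponent z₀, ∀ z' ∈ connectedComponent z₀, G z = G z' → z = z' := by
    intro z hz z' hz' h
    rw [← hψr] at hz hz'
    obtain ⟨a, rfl⟩ := hz
    obtain ⟨b, rfl⟩ := hz'
    rw [hGψ, hGψ] at h
    rw [h]
  have := locallyConnectedSpace_orientedPreimage (ι := ι)
  have hopen : IsOpen (connectedComponent z₀) := isOpen_connectedComponent
  have hcpt : IsCompact (connectedComponent z₀) := isClosed_connectedComponent.isCompact
  let e : USphere n := u
  let h : orientedPreimage ι → ℝ := fun z =>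
    stereoHeight (p₀ : EuclideanSpace ℝ (Fin (n + 2))) (K e) z.1.2.1
  have hc : Continuous h := by
    refine Continuous.div (by fun_prop) (by fun_prop) fun z => ?_
    exact sub_ne_zero.2 (hp _ _ (proj_of_mem_orientedPreimage z.2)).symm
  obtain ⟨z₁, hz₁, hmax⟩ := hcpt.exists_isMaxOn ⟨z₀, mem_connectedComponent⟩ hc.continuousOn
  obtain ⟨z₂, hz₂, hmin⟩ := hcpt.exists_isMinOn ⟨z₀, mem_connectedComponent⟩ hc.continuousOn
  have hval : ∀ z ∈ connectedComponent z₀, IsExtrOn h (connectedComponent z₀) z →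
      h z = h (ψ e) := by
    intro z hz hext
    rcases hG.eq_or_eq_neg hp e hopen hz hext with h3 | h3
    · rw [hinj z hz (ψ e) (hψN e) (h3.trans (hGψ e).symm)]
    · have h4 : flipNormal z = ψ e := by
        refine hinj _ (hN z hz) (ψ e) (hψN e) ?_
        rw [hG.map_flipNormal, h3, neg_neg, hGψ]
      rw [← h4]
      rfl
  have h₁ := hval z₁ hz₁ hmax.isExtr
  have h₂ := hval z₂ hz₂ hmin.isExtr
  obtain ⟨w, hw, hw'⟩ := exists_ne_and_ne_neg hn e
  have hconst : IsExtrOn h (connectedComponent z₀) (ψ w) := by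
    left
    intro z hz
    have h3 : h z₂ ≤ h z := hmin hz
    have h4 : h (ψ w) ≤ h z₁ := hmax (hψN w)
    have h5 : h (ψ w) ≤ h z := by linarith
    exact h5
  rcases hG.eq_or_eq_neg hp e hopen (hψN w) hconst with h3 | h3
  · exact hw ((hGψ w).symm.trans h3)
  · exact hw' ((hGψ w).symm.trans h3)

end Components

/-! ### Group actions that permute the components of a space -/

section ComponentAction

open scoped Pointwise

variable {Γ X : Type*} [Group Γ] [TopologicalSpace X] [MulAction Γ X]
  [ContinuousConstSMul Γ X]

theorem smul_set_connectedComponent (g : Γ) (x : X) :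
    g • connectedComponent x = connectedComponent (g • x) := by
  have h : ∀ (g : Γ) (x : X), g • connectedComponent x ⊆ connectedComponent (g • x) :=
    fun g x => (continuous_const_smul g).image_connectedComponent_subset x
  refine (h g x).antisymm ?_
  have h1 := h g⁻¹ (g • x)
  rwa [inv_smul_smul, Set.smul_set_subset_iff_subset_inv_smul_set, inv_inv] at h1

variable [LocallyConnectedSpace X] [CompactSpace X] {Y : Type*} [TopologicalSpace Y] [T2Space Y]
  [ConnectedSpace Y] {q : X → Y}

/-- A compact space that is locally homeomorphic to a connected one covers it by each of its
components. -/
theorem IsLocalHomeomorph.image_connectedComponent (hq : IsLocalHomeomorph q) (z : X) :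
    q '' connectedComponent z = Set.univ :=
  IsClopen.eq_univ ⟨(isClosed_connectedComponent.isCompact.image hq.continuous).isClosed,
    hq.isOpenMap _ isOpen_connectedComponent⟩ ⟨q z, z, mem_connectedComponent, rfl⟩

theorem exists_connectedComponent_eq_smul (hq : IsLocalHomeomorph q)
    (hqΓ : ∀ x y, q x = q y ↔ x ∈ MulAction.orbit Γ y) (z x : X) :
    ∃ g : Γ, connectedComponent x = connectedComponent (g • z) := by
  obtain ⟨y, hy, hyx⟩ : q x ∈ q '' connectedComponent z := by
    rw [hq.image_connectedComponent]
    trivial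
  obtain ⟨g, hg⟩ := (hqΓ x y).1 hyx.symm
  refine ⟨g, ?_⟩
  have hg : g • y = x := hg
  rw [← hg, ← smul_set_connectedComponent, ← smul_set_connectedComponent, connectedComponent_eq hy]

/-- The components form one orbit, so their number is the index of the stabilizer of one. -/
theorem card_connectedComponents_mul_card_stabilizer (hq : IsLocalHomeomorph q)
    (hqΓ : ∀ x y, q x = q y ↔ x ∈ MulAction.orbit Γ y) (z : X) :
    Nat.card (ConnectedComponents X) * Nat.card (MulAction.stabilizer Γ (connectedComponent z)) =
      Nat.card Γ := by
  let c : ConnectedComponents X → Set X := Quotient.lift connectedComponent fun _ _ h => h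
  have hc : Function.Injective c := by
    intro a b
    obtain ⟨x, rfl⟩ := ConnectedComponents.surjective_coe a
    obtain ⟨y, rfl⟩ := ConnectedComponents.surjective_coe b
    exact fun h => ConnectedComponents.coe_eq_coe.2 h
  have hr : Set.range c = MulAction.orbit Γ (connectedComponent z) := by
    ext t
    constructor
    · rintro ⟨a, rfl⟩
      obtain ⟨x, rfl⟩ := ConnectedComponents.surjective_coe a
      obtain ⟨g, hg⟩ := exists_connectedComponent_eq_smul hq hqΓ z x
      exact ⟨g, (smul_set_connectedComponent g z).trans hg.symm⟩
    · rintro ⟨g, rfl⟩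
      exact ⟨(g • z : X), (smul_set_connectedComponent g z).symm⟩
  rw [← Nat.card_range_of_injective hc, hr, mul_comm, Nat.card_coe_set_eq,
    ← MulAction.index_stabilizer, Subgroup.card_mul_index]

/-- If the fibres of a local homeomorphism `q` from a compact space to a connected one are the
orbits of a free action, then the restriction of `q` to a component, here parametrized by a
map `s`, is the quotient map by the action of the stabilizer of the component. -/
theorem IsLocalHomeomorph.exists_isQuotientCoveringMap [T2Space X] [IsCancelSMul Γ X]
    (hq : IsLocalHomeomorph q) (hqΓ : ∀ x y, q x = q y ↔ x ∈ MulAction.orbit Γ y) {Z : Type*}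
    [TopologicalSpace Z] [CompactSpace Z] {s : Z → X} (hs : Continuous s)
    (hinj : Function.Injective s) {z : X} (hz : Set.range s = connectedComponent z) :
    ∃ (H : Subgroup Γ) (_ : MulAction H Z),
      Nat.card (ConnectedComponents X) * Nat.card H = Nat.card Γ ∧
      (∀ (h : H) (u : Z), s (h • u) = (h : Γ) • s u) ∧ IsQuotientCoveringMap (q ∘ s) H := by
  have hemb := hs.isClosedEmbedding hinj
  have hopen : Topology.IsOpenEmbedding s :=
    ⟨hemb.isEmbedding, by rw [hz]; exact isOpen_connectedComponent⟩
  have : T2Space Z := hemb.isEmbedding.t2Space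
  let H := MulAction.stabilizer Γ (connectedComponent z)
  have hH : ∀ (h : H) (u : Z), ∃ v, s v = (h : Γ) • s u := by
    intro h u
    change (h : Γ) • s u ∈ Set.range s
    have h1 : (h : Γ) • connectedComponent z = connectedComponent z := h.2
    rw [hz, ← h1]
    exact Set.smul_mem_smul_set (hz ▸ Set.mem_range_self u)
  -- `s` identifies `Z` with the component, on which the stabilizer `H` acts.
  choose a ha using hH
  let A : MulAction H Z :=
    { smul := a
      one_smul := fun u => hinj ((ha 1 u).trans (one_smul Γ _))
      mul_smul := fun g h u => hinj (by
        change s (a (g * h) u) = s (a g (a h u))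
        rw [ha, ha, ha, Subgroup.coe_mul, mul_smul]) }
  have hA : ∀ (h : H) (u : Z), s (h • u) = (h : Γ) • s u := ha
  refine ⟨H, A, card_connectedComponents_mul_card_stabilizer hq hqΓ z, hA, ?_⟩
  refine (isQuotientCoveringMap_iff_isCoveringMap_and _ _).2 ⟨isLocalHomeomorph_iff_isCoveringMap.1
    (hq.comp hopen.isLocalHomeomorph), fun y => ?_, ⟨fun h => ?_⟩,
    isCancelSMul_iff_eq_one_of_smul_eq.2 fun h u hu => ?_, fun {u v} => ?_⟩
  · obtain ⟨x, hx, rfl⟩ : y ∈ q '' connectedComponent z := by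
      rw [hq.image_connectedComponent]
      trivial
    rw [← hz] at hx
    obtain ⟨u, rfl⟩ := hx
    exact ⟨u, rfl⟩
  · rw [hemb.isInducing.continuous_iff]
    exact (hs.const_smul (h : Γ)).congr fun u => (hA h u).symm
  · refine Subtype.ext ?_
    refine isCancelSMul_iff_eq_one_of_smul_eq.1 (inferInstance : IsCancelSMul Γ X) (h : Γ) (s u) ?_
    rw [← hA, hu]
  · constructor
    · intro huv
      obtain ⟨g, hg⟩ := (hqΓ _ _).1 huv
      have hg : g • s v = s u := hg
      have hgH : g ∈ H := by
        have h1 : ∀ w, connectedComponent (s w) = connectedComponent z := fun w =>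
          (connectedComponent_eq (hz ▸ Set.mem_range_self w)).symm
        change g • connectedComponent z = connectedComponent z
        rw [← h1 v, smul_set_connectedComponent, hg, h1, h1]
      exact ⟨⟨g, hgH⟩, hinj ((hA _ _).trans hg)⟩
    · rintro ⟨h, rfl⟩
      exact (hqΓ _ _).2 ⟨h, (hA h v).symm⟩

theorem IsQuotientCoveringMap.card_fiber {G E B : Type*} [TopologicalSpace E]
    [TopologicalSpace B] [Group G] [MulAction G E] {f : E → B} (hf : IsQuotientCoveringMap f G)
    (x : B) : Nat.card (f ⁻¹' {x}) = Nat.card G := by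
  obtain ⟨u, rfl⟩ := hf.surjective x
  have := hf.isCancelSMul
  refine (Nat.card_congr (Equiv.ofBijective
    (fun g : G => (⟨g • u, hf.map_smul g⟩ : f ⁻¹' {f u})) ⟨fun g h hgh => ?_, fun v => ?_⟩)).symm
  · exact IsCancelSMul.right_cancel _ _ u (congrArg Subtype.val hgh)
  · obtain ⟨g, hg⟩ := hf.apply_eq_iff_mem_orbit.1 v.2
    exact ⟨g, Subtype.ext hg⟩

end ComponentAction

/-! ### The preimage of the hypersurface -/

section Preimage

variable {n : ℕ} {M : Type*} [TopologicalSpace M] [ChartedSpace (EuclideanSpace ℝ (Fin n)) M]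
  {Γ : Type*} [Group Γ] [MulAction Γ (USphere (n + 1))] {ι : M → SpaceForm Γ (n + 1)}

/-- The group `Γ` acts on the second coordinate. -/
instance HypersurfacePreimage.instMulAction : MulAction Γ (HypersurfacePreimage ι) where
  smul g z := ⟨(z.1.1, g • z.1.2), z.2.trans (spaceFormProj_smul g _).symm⟩
  one_smul z := Subtype.ext (Prod.ext rfl (one_smul Γ z.1.2))
  mul_smul g h z := Subtype.ext (Prod.ext rfl (mul_smul g h z.1.2))

theorem HypersurfacePreimage.fst_eq_fst_iff {M : Type*} {ι : M → SpaceForm Γ (n + 1)}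
    (z w : HypersurfacePreimage ι) :
    z.1.1 = w.1.1 ↔ z ∈ MulAction.orbit Γ w := by
  constructor
  · intro h
    obtain ⟨g, hg⟩ := spaceFormProj_eq_iff.1 (z.2.symm.trans ((congrArg ι h).trans w.2))
    exact ⟨g, Subtype.ext (Prod.ext h.symm hg)⟩
  · rintro ⟨g, rfl⟩
    rfl

/-- The point of the preimage of the hypersurface under a point of the oriented preimage. -/
def forgetNormal (z : orientedPreimage ι) : HypersurfacePreimage ι :=
  ⟨(z.1.1, z.1.2.1), proj_of_mem_orientedPreimage z.2⟩

theorem continuous_forgetNormal : Continuous (forgetNormal (ι := ι)) :=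
  Continuous.subtype_mk (by fun_prop) _

variable [IsIsometricSMul Γ (USphere (n + 1))] [ActsProperlyDiscontinuously Γ (USphere (n + 1))]

instance HypersurfacePreimage.instContinuousConstSMul :
    ContinuousConstSMul Γ (HypersurfacePreimage ι) where
  continuous_const_smul g := by
    have hg : Continuous fun p : USphere (n + 1) => g • p := (isometry_smul _ g).continuous
    refine Continuous.subtype_mk (f := fun z : HypersurfacePreimage ι => (z.1.1, g • z.1.2)) ?_ _
    exact (continuous_fst.comp continuous_subtype_val).prodMk
      (hg.comp (continuous_snd.comp continuous_subtype_val))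

instance HypersurfacePreimage.instIsCancelSMul : IsCancelSMul Γ (HypersurfacePreimage ι) :=
  isCancelSMul_iff_eq_one_of_smul_eq.2 fun g z hz =>
    isCancelSMul_iff_eq_one_of_smul_eq.1 (inferInstance : IsCancelSMul Γ (USphere (n + 1))) g z.1.2
      (congrArg (fun w => w.1.2) hz)

theorem compactSpace_hypersurfacePreimage [CompactSpace M]
    (hι : Manifold.IsImmersion (𝓡 n) (𝓡 (n + 1)) ∞ ι) : CompactSpace (HypersurfacePreimage ι) := by
  have hιc : Continuous ι := continuous_iff_continuousAt.2 fun x =>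
    (hι.isImmersionAt x).continuousAt
  have hπc : Continuous (spaceFormProj Γ (m := n + 1)) :=
    isQuotientCoveringMap_spaceFormProj.continuous
  exact isCompact_iff_compactSpace.1
    (isClosed_eq (hιc.comp continuous_fst) (hπc.comp continuous_snd)).isCompact

variable [IsManifold (𝓡 n) ∞ M]

theorem isLocalHomeomorph_fst_hypersurfacePreimage
    (hι : Manifold.IsImmersion (𝓡 n) (𝓡 (n + 1)) ∞ ι) :
    IsLocalHomeomorph (fun z : HypersurfacePreimage ι => z.1.1) := by
  classical
  refine IsLocalHomeomorph.of_local_sections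
    (continuous_fst.comp continuous_subtype_val) fun z => ?_
  obtain ⟨⟨x, p⟩, hxp⟩ := z
  obtain ⟨U, f, η, h, hx, hf⟩ := exists_isOrientedLift (hι.isImmersionAt x) hxp
  obtain rfl : f x = p := hf
  let s : M → HypersurfacePreimage ι := fun y => if hy : y ∈ U then
    ⟨(y, f y), (h.proj_eq y hy).symm⟩ else ⟨(x, f x), (h.proj_eq x hx).symm⟩
  have hs : ∀ y ∈ U, (s y).1 = (y, f y) := fun y hy => by simp [s, hy]
  refine ⟨U, s, h.isOpen, hx, ?_, fun y hy => by rw [hs y hy], ?_⟩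
  · refine Topology.IsInducing.subtypeVal.continuousOn_iff.2 ?_
    exact (continuousOn_id.prodMk h.contMDiffOn.continuousOn).congr hs
  · have := (continuous_subtype_val.tendsto (⟨(x, f x), hxp⟩ :
      HypersurfacePreimage ι)).eventually (h.eventually_eq hx)
    filter_upwards [this] with z hz
    refine Subtype.ext ((hs _ hz.1).trans (Prod.ext rfl (hz.2 z.2)))

/-- The image of a component of the oriented preimage is a component of the preimage. -/
theorem image_forgetNormal_connectedComponent [T2Space M] [CompactSpace M]
    (hι : Manifold.IsImmersion (𝓡 n) (𝓡 (n + 1)) ∞ ι) (z : orientedPreimage ι) :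
    forgetNormal '' connectedComponent z = connectedComponent (forgetNormal z) := by
  have := locallyConnectedSpace_orientedPreimage (ι := ι)
  have := compactSpace_orientedPreimage hι
  have hloc : IsLocalHomeomorph (forgetNormal (ι := ι)) :=
    IsLocalHomeomorph.of_comp (g := fun z : HypersurfacePreimage ι => z.1.1)
      (isLocalHomeomorph_fst_orientedPreimage (ι := ι))
      (isLocalHomeomorph_fst_hypersurfacePreimage hι) continuous_forgetNormal
  refine (continuous_forgetNormal.image_connectedComponent_subset z).antisymm ?_
  exact IsClopen.connectedComponent_subset
    ⟨(isClosed_connectedComponent.isCompact.image continuous_forgetNormal).isClosed,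
      hloc.isOpenMap _ isOpen_connectedComponent⟩ ⟨z, mem_connectedComponent, rfl⟩

end Preimage

/-! ### Smoothness of the parametrization by the sphere -/

section Smoothness

variable {n : ℕ} {M : Type*} [TopologicalSpace M] [ChartedSpace (EuclideanSpace ℝ (Fin n)) M]

/-- A continuous self-map that preserves the values of a local diffeomorphism is smooth. -/
theorem IsLocalDiffeomorph.contMDiff_of_comp_eq {f : USphere n → M}
    (hf : IsLocalDiffeomorph (𝓡 n) (𝓡 n) ∞ f) {a : USphere n → USphere n} (ha : Continuous a)
    (hfa : ∀ u, f (a u) = f u) : ContMDiff (𝓡 n) (𝓡 n) ∞ a := by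
  intro u
  obtain ⟨Φ, hu, hΦ⟩ := hf (a u)
  have hev : a =ᶠ[𝓝 u] fun v => Φ.symm (f v) := by
    filter_upwards [ha.continuousAt.eventually (Φ.open_source.mem_nhds hu)] with v hv
    rw [← hfa v, hΦ hv]
    exact (Φ.left_inv hv).symm
  have hfu : f u ∈ Φ.target := by
    rw [← hfa u, hΦ hu]
    exact Φ.map_source hu
  refine ContMDiffAt.congr_of_eventuallyEq ?_ hev
  exact (Φ.symm.contMDiffOn.contMDiffAt (Φ.open_target.mem_nhds hfu)).comp u
    (hf u).contMDiffAt

variable {Γ : Type*} [Group Γ] [MulAction Γ (USphere (n + 1))]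
  {ι : M → SpaceForm Γ (n + 1)} {p₀ : USphere (n + 1)}
  {K : EuclideanSpace ℝ (Fin (n + 1)) →L[ℝ] EuclideanSpace ℝ (Fin (n + 2))}
  {G : orientedPreimage ι → USphere n} {ψ : USphere n → orientedPreimage ι}

/-- The inverse of the Gauss map parametrizes the hypersurface by a local diffeomorphism, since
the Gauss map is one when it is read in the hypersurface. -/
theorem IsGaussMap.isLocalDiffeomorph_section (hG : IsGaussMap p₀ K G) (hψ : Continuous ψ)
    (hGψ : ∀ u, G (ψ u) = u) :
    IsLocalDiffeomorph (𝓡 n) (𝓡 n) ∞ (fun u => (ψ u).1.1) := by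
  intro u
  obtain ⟨γ, ⟨Φ, hx, hΦ⟩, hγ⟩ := hG.isLocalDiffeomorphAt (ψ u)
  have hc : Continuous fun u => (ψ u).1.1 := by fun_prop
  have hγu : ∀ᶠ v in 𝓝 u, γ (ψ v).1.1 = v :=
    (hψ.continuousAt.eventually hγ).mono fun v hv => hv.symm.trans (hGψ v)
  have hu : u ∈ Φ.target := by
    rw [← hγu.self_of_nhds, hΦ hx]
    exact Φ.map_source hx
  refine (Φ.symm.isLocalDiffeomorphAt (𝓡 n) (𝓡 n) ∞ hu).congr_of_eventuallyEq ?_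
  filter_upwards [hγu, hc.continuousAt.eventually (Φ.open_source.mem_nhds hx)] with v hv hv'
  have h1 : Φ (ψ v).1.1 = v := (hΦ hv').symm.trans hv
  exact (congrArg Φ.symm h1).symm.trans (Φ.left_inv hv')

theorem contMDiff_section_sphere [IsIsometricSMul Γ (USphere (n + 1))]
    [ActsProperlyDiscontinuously Γ (USphere (n + 1))] (hψ : Continuous ψ)
    (hf : ContMDiff (𝓡 n) (𝓡 n) ∞ (fun u => (ψ u).1.1)) :
    ContMDiff (𝓡 n) (𝓡 (n + 1)) ∞ (fun u => (ψ u).1.2.1) := by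
  intro u
  obtain ⟨U, g, η, h, hx, hg, -⟩ := (ψ u).2
  have hc : Continuous fun u => ((ψ u).1.1, (ψ u).1.2.1) := by fun_prop
  have hev := h.eventually_eq hx
  rw [hg] at hev
  replace hev := (hc.tendsto u).eventually hev
  refine ContMDiffAt.congr_of_eventuallyEq
    ((h.contMDiffOn.contMDiffAt (h.isOpen.mem_nhds hx)).comp u (hf u)) ?_
  filter_upwards [hev] with v hv
  exact (hv.2 (proj_of_mem_orientedPreimage (ψ v).2)).symm

end Smoothness

/-! ### The covering by the sphere -/

theorem finite_of_actsProperlyDiscontinuously {Γ X : Type*} [Group Γ] [TopologicalSpace X]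
    [CompactSpace X] [MulAction Γ X] [ActsProperlyDiscontinuously Γ X] [Nonempty X] : Finite Γ := by
  have h := ProperlyDiscontinuousSMul.finite_disjoint_inter_image (Γ := Γ) (T := X)
    isCompact_univ isCompact_univ
  refine Set.finite_univ_iff.1 (h.subset fun g _ => ?_)
  obtain ⟨x⟩ := (inferInstance : Nonempty X)
  have h1 : ((g • ·) '' (Set.univ : Set X) ∩ Set.univ).Nonempty :=
    ⟨g • x, ⟨x, trivial, rfl⟩, trivial⟩
  exact h1

theorem theorem2 (n : ℕ) (hn : 2 ≤ n)
    (Γ : Type*) [Group Γ] [Nontrivial Γ] [MulAction Γ (USphere (n + 1))]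
    [IsIsometricSMul Γ (USphere (n + 1))] [ActsProperlyDiscontinuously Γ (USphere (n + 1))]
    (x₀ : SpaceForm Γ (n + 1)) (p₀ : USphere (n + 1)) (hp₀ : spaceFormProj Γ p₀ = x₀)
    (r : ℝ) (hr : IsLeast {d : ℝ | ∃ g : Γ, g ≠ 1 ∧ d = sphereDist p₀ (g • p₀)} r)
    (M : Type*) [TopologicalSpace M] [T2Space M] [CompactSpace M] [ConnectedSpace M]
    [ChartedSpace (EuclideanSpace ℝ (Fin n)) M] [IsManifold (𝓡 n) ∞ M]
    (ι : M → SpaceForm Γ (n + 1)) (hι : Manifold.IsImmersion (𝓡 n) (𝓡 (n + 1)) ∞ ι)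
    (R : ℝ) (hR : R ∈ Set.Ioo 0 (r / 2))
    (hdist : ∀ x : M, spaceFormInfDist (ι x) (cutLocus x₀) ≤ R)
    (hcurv : ∃ c : ℝ, Real.cot ((r - 2 * R) / 4) < c ∧
      ∀ (x : M) (μ : ℝ), IsPrincipalCurvature ι x μ → c ≤ |μ|)
    (k : ℕ) (hk : Nat.card (ConnectedComponents (HypersurfacePreimage ι)) = k) :
    Finite Γ ∧
    ∃ (f : USphere n → M) (φ : USphere n → USphere (n + 1)),
      -- `f` is a smooth covering map which is `(|Γ| / k)`-to-one
      IsCoveringMap f ∧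
      IsLocalDiffeomorph (𝓡 n) (𝓡 n) ∞ f ∧
      (∀ x : M, k * Nat.card (f ⁻¹' {x}) = Nat.card Γ) ∧
      -- `f` is the restriction of the projection to a component, parametrized by `S^n`
      ContMDiff (𝓡 n) (𝓡 (n + 1)) ∞ φ ∧
      (∃ (hφ : ∀ u, ι (f u) = spaceFormProj Γ (φ u)) (z : HypersurfacePreimage ι),
        Topology.IsEmbedding (fun u => (⟨(f u, φ u), hφ u⟩ : HypersurfacePreimage ι)) ∧
        Set.range (fun u => (⟨(f u, φ u), hφ u⟩ : HypersurfacePreimage ι)) =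
          connectedComponent z) ∧
      -- `f` is the quotient map of `S^n` by a smooth free action of a subgroup of `Γ`
      ∃ (H : Subgroup Γ) (_ : MulAction H (USphere n)),
        k * Nat.card H = Nat.card Γ ∧
        (∀ h : H, ContMDiff (𝓡 n) (𝓡 n) ∞ (fun u : USphere n => h • u)) ∧
        (∀ (h : H) (u : USphere n), φ (h • u) = (h : Γ) • φ u) ∧
        IsQuotientCoveringMap f H := by
  have : Nonempty (USphere (n + 1)) := ⟨p₀⟩
  refine ⟨finite_of_actsProperlyDiscontinuously (X := USphere (n + 1)), ?_⟩
  -- The lifted hypersurface keeps the distance `2 * a = r / 2 - R` from `p₀`.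
  obtain ⟨⟨g, -, hg⟩, hmin⟩ := hr
  have hrpi : r ≤ Real.pi := hg ▸ sphereDist_le_pi _ _
  have hr0 : 0 ≤ r := hg ▸ sphereDist_nonneg _ _
  have hpi := Real.pi_pos
  set a := (r - 2 * R) / 4 with ha
  have ha0 : 0 < a := by linarith [hR.2]
  have ha1 : 2 * a < Real.pi / 2 := by linarith [hR.1]
  have hp : ∀ x p, ι x = spaceFormProj Γ p →
      inner ℝ (p : EuclideanSpace ℝ (Fin (n + 2))) (p₀ : EuclideanSpace ℝ (Fin (n + 2))) ≤
        Real.cos (2 * a) := by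
    intro x p hxp
    have h1 : r / 2 - R ≤ sphereDist p₀ p := sub_le_sphereDist hp₀ hrpi hr0
      (fun g hg => hmin ⟨g, hg, rfl⟩) (hxp ▸ hdist x)
    have h2 : Real.cos (sphereDist p₀ p) =
        inner ℝ (p : EuclideanSpace ℝ (Fin (n + 2))) (p₀ : EuclideanSpace ℝ (Fin (n + 2))) := by
      rw [sphereDist, InnerProductGeometry.cos_angle, norm_eq_of_mem_sphere,
        norm_eq_of_mem_sphere, mul_one, div_one, real_inner_comm]
    rw [← h2]
    exact Real.cos_le_cos_of_nonneg_of_le_pi (by linarith) (sphereDist_le_pi _ _) (by linarith)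
  have hcos : Real.cos (2 * a) < 1 := by
    rw [← Real.cos_zero]
    exact Real.cos_lt_cos_of_nonneg_of_le_pi le_rfl (by linarith) (by linarith)
  have hp1 : ∀ x p, ι x = spaceFormProj Γ p →
      inner ℝ (p : EuclideanSpace ℝ (Fin (n + 2))) (p₀ : EuclideanSpace ℝ (Fin (n + 2))) ≠
        (1 : ℝ) := fun x p hxp => ((hp x p hxp).trans_lt hcos).ne
  obtain ⟨c, hac, hc⟩ := hcurv
  -- Every principal curvature exceeds `cot a` in absolute value, and so differs from the
  -- coefficient `⟪ζ, p₀⟫ / (1 - ⟪p, p₀⟫)`.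
  obtain ⟨K, G, hG⟩ := exists_isGaussMap (ι := ι) p₀ hp1 fun z hz hpc => by
    have h1 := proj_of_mem_orientedPreimage hz
    have h2 := abs_inner_div_le_cot (norm_eq_of_mem_sphere p₀) (norm_eq_of_mem_sphere z.2.1)
      (isUnitNormal_of_mem_orientedPreimage hz).1 (isUnitNormal_of_mem_orientedPreimage hz).2
      (Real.sin_pos_of_pos_of_lt_pi ha0 (by linarith))
      (Real.cos_nonneg_of_neg_pi_div_two_le_of_le (by linarith) (by linarith)) (hp _ _ h1)
    exact absurd (hc _ _ hpc) (not_le.2 (h2.trans_lt hac))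
  have := compactSpace_orientedPreimage hι
  have := compactSpace_hypersurfacePreimage hι
  have hq := isLocalHomeomorph_fst_hypersurfacePreimage hι
  have : LocallyConnectedSpace M :=
    ChartedSpace.locallyConnectedSpace (EuclideanSpace ℝ (Fin n)) M
  have := hq.locallyConnectedSpace
  obtain ⟨z₀⟩ : Nonempty (orientedPreimage ι) := by
    obtain ⟨x⟩ := (inferInstance : Nonempty M)
    obtain ⟨p, hxp⟩ := spaceFormProj_surjective (ι x)
    obtain ⟨U, f, η, h, hx, -⟩ := exists_isOrientedLift (hι.isImmersionAt x) hxp.symm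
    exact ⟨⟨_, h.mem_orientedPreimage hx⟩⟩
  obtain ⟨ψ, hψ, hGψ, hψr⟩ := hG.exists_section hn z₀
  have hf := hG.isLocalDiffeomorph_section hψ hGψ
  have hs : Continuous (forgetNormal ∘ ψ) := continuous_forgetNormal.comp hψ
  have hinj : Function.Injective (forgetNormal ∘ ψ) := fun u v huv =>
    hG.eq_of_eq (by omega) hp1 hGψ hψr (congrArg (fun w => w.1.1) huv)
      (congrArg (fun w => w.1.2) huv)
  have hrange : Set.range (forgetNormal ∘ ψ) = connectedComponent (forgetNormal z₀) := by
    rw [Set.range_comp, hψr, image_forgetNormal_connectedComponent hι]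
  obtain ⟨H, A, hcard, hA, hquot⟩ := hq.exists_isQuotientCoveringMap
    HypersurfacePreimage.fst_eq_fst_iff hs hinj hrange
  rw [hk] at hcard
  have hquot' : IsQuotientCoveringMap (fun u => (ψ u).1.1) H := hquot
  refine ⟨fun u => (ψ u).1.1, fun u => (ψ u).1.2.1, hquot'.isCoveringMap, hf, fun x => ?_,
    contMDiff_section_sphere hψ hf.contMDiff,
    ⟨fun u => proj_of_mem_orientedPreimage (ψ u).2, forgetNormal z₀,
      (hs.isClosedEmbedding hinj).isEmbedding, hrange⟩,
    H, A, hcard, fun h => ?_, fun h u => ?_, hquot'⟩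
  · rw [hquot'.card_fiber, hcard]
  · exact hf.contMDiff_of_comp_eq (hquot'.continuous_const_smul h) fun u => hquot'.map_smul h
  · exact congrArg (fun w => w.1.2) (hA h u)
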